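/- Let $\mathcal W$ be a bicategory whose hom-categories are locally small, complete and cocomplete, and which is biclosed: for each $1$-cell $A\colon x\to y$ and each object $z$, the functors $A\otimes(-)\colon \mathcal W(z,x)\to\mathcal W(z,y)$ and $(-)\otimes A\colon\mathcal W(y,z)\to\mathcal W(x,z)$ given by composition with $A$ have right adjoints. A $\mathcal W$-category $\mathcal A$ has a set of objects, an extent $\epsilon a\in\mathcal W$ for each object $a$, hom-objects $\mathcal A(b,a)\in\mathcal W(\epsilon a,\epsilon b)$, and identity and composition $2$-cells $I_{\epsilon a}\to\mathcal A(a,a)$ and $\mathcal A(c,b)\otimes\mathcal A(b,a)\to\mathcal A(c,a)$ that are unital and associative. A $\mathcal W$-functor is an extent-preserving map on objects together with $2$-cells on hom-objects that respect identities and composition. A profunctor $M\colon\mathcal A\nrightarrow\mathcal B$ consists of $1$-cells $M(b,a)\in\mathcal W(\epsilon a,\epsilon b)$ with unital, associative and mutually compatible actions of $\mathcal A$ and $\mathcal B$; profunctor maps are families of $2$-cells compatible with the actions. For $\mathcal B$ small, profunctors $M\colon\mathcal A\nrightarrow\mathcal B$ and $N\colon\mathcal B\nrightarrow\mathcal D$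 have a tensor product $N\otimes_{\mathcal B}M\colon\mathcal A\nrightarrow\mathcal D$, with $(N\otimes_{\mathcal B}M)(d,a)$ the coequaliser of the two maps $\sum_{b,b'}N(d,b)\otimes\mathcal B(b,b')\otimes M(b',a)\rightrightarrows\sum_b N(d,b)\otimes M(b,a)$ given by the actions. Small $\mathcal W$-categories, profunctors and profunctor maps form a bicategory $\mathcal W\text{-}\mathbf{Mod}$, with composition $\otimes$ and identities $\mathcal A=\mathcal A(-,-)$. For $\mathcal W$-functors $F\colon\mathcal A\to\mathcal C$ and $G\colon\mathcal B\to\mathcal C$ there is a profunctor $\mathcal C(G,F)\colon\mathcal A\nrightarrow\mathcal B$ with components $\mathcal C(Gb,Fa)$; we write $\mu$ for the profunctor maps induced by composition in $\mathcal C$, and $F\colon\mathcal A\to\mathcal C(F,F)$ for the action of $F$ on homs. An object $C$ of $\mathcal C$ is identified with a functor into $\mathcal C$ from the $\mathcal W$-category with one object, of extent $\epsilon C$, and hom-object $I_{\epsilon C}$. A map $u\colon N\otimes_{\mathcal B}M\to L$ exhibits $M$ as $[N,L]$ if every $f\colon N\otimes_{\mathcal B}K\to L$ equals $u\circ(N\otimes_{\mathcal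 B}\bar f)$ for a unique $\bar f\colon K\to M$, and exhibits $N$ as $\langle M,L\rangle$ if every $f\colon K\otimes_{\mathcal B}M\to L$ equals $u\circ(\bar f\otimes_{\mathcal B}M)$ for a unique $\bar f\colon K\to N$. Let $F\colon\mathcal B\to\mathcal C$ and $Z\colon\mathcal A\to\mathcal C$ be $\mathcal W$-functors with $\mathcal A,\mathcal B$ small. For $\varphi\colon\mathcal A\nrightarrow\mathcal B$, a map $a\colon\varphi\to\mathcal C(F,Z)$ exhibits $Z$ as a $\varphi$-weighted colimit of $F$ if for each $C\in\mathcal C$ the map $$\varphi\otimes_{\mathcal A}\mathcal C(Z,C)\xrightarrow{a\otimes 1}\mathcal C(F,Z)\otimes_{\mathcal A}\mathcal C(Z,C)\xrightarrow{\mu}\mathcal C(F,C)$$ exhibits $\mathcal C(Z,C)$ as $[\varphi,\mathcal C(F,C)]$. For $\psi\colon\mathcal B\nrightarrow\mathcal A$, a map $b\colon\psi\to\mathcal C(Z,F)$ exhibits $Z$ as a $\psi$-weighted limit of $F$ if for each $C\in\mathcal C$ the map $$\mathcal C(C,Z)\otimes_{\mathcal A}\psi\xrightarrow{1\otimes b}\mathcal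 C(C,Z)\otimes_{\mathcal A}\mathcal C(Z,F)\xrightarrow{\mu}\mathcal C(C,F)$$ exhibits $\mathcal C(C,Z)$ as $\langle\psi,\mathcal C(C,F)\rangle$. **Theorem.** Let $\mathcal A,\mathcal B$ be small $\mathcal W$-categories, let $\mathcal C$ be a (possibly large) $\mathcal W$-category, let $\varphi\colon\mathcal A\nrightarrow\mathcal B$ have the right adjoint $\psi\colon\mathcal B\nrightarrow\mathcal A$ in $\mathcal W\text{-}\mathbf{Mod}$, with unit $\eta\colon\mathcal A\to\psi\otimes_{\mathcal B}\varphi$ and counit $\varepsilon\colon\varphi\otimes_{\mathcal A}\psi\to\mathcal B$, and let $F\colon\mathcal B\to\mathcal C$ and $Z\colon\mathcal A\to\mathcal C$ be $\mathcal W$-functors. Then data of the following three forms are in bijective correspondence: (a) maps $a\colon\varphi\to\mathcal C(F,Z)$ exhibiting $Z$ as a $\varphi$-weighted colimit of $F$; (b) maps $b\colon\psi\to\mathcal C(Z,F)$ exhibiting $Z$ as a $\psi$-weighted limit of $F$; (c) pairs of maps $a\colon\varphi\to\mathcal C(F,Z)$ and $b\colon\psi\to\mathcal C(Z,F)$ such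 that $$\mu\circ(b\otimes_{\mathcal B}a)\circ\eta=Z\colon\mathcal A\to\mathcal C(Z,Z)\qquad\text{and}\qquad \mu\circ(a\otimes_{\mathcal A}b)=F\circ\varepsilon\colon\varphi\otimes_{\mathcal A}\psi\to\mathcal C(F,F).$$ More precisely, the projections $(a,b)\mapsto a$ and $(a,b)\mapsto b$ are bijections from the data (c) onto the data (a) and onto the data (b), respectively. -/

import Mathlib

open CategoryTheory Bicategory Limits

universe w v u u₁ u₂

/-- A bicategory whose homs are complete and cocomplete (locally small) categories, and which is
biclosed: both composition functors with a fixed 1-cell have right adjoints. Here "small" refers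
to the universe of the 2-cells. -/
class BiclosedBicategory (W : Type u) [Bicategory.{w, v} W] : Prop where
  complete : ∀ x y : W, HasLimits (x ⟶ y)
  cocomplete : ∀ x y : W, HasColimits (x ⟶ y)
  postcomp_isLeftAdjoint : ∀ {x y : W} (f : x ⟶ y) (z : W), (postcomp z f).IsLeftAdjoint
  precomp_isLeftAdjoint : ∀ {x y : W} (f : x ⟶ y) (z : W), (precomp z f).IsLeftAdjoint

attribute [instance] BiclosedBicategory.complete BiclosedBicategory.cocomplete
  BiclosedBicategory.postcomp_isLeftAdjoint BiclosedBicategory.precomp_isLeftAdjoint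

/-- A category enriched in the bicategory `W`. The 1-cell `hom a b : ext a ⟶ ext b` is the
hom-object usually written `A(b, a)`; composition of 1-cells is in diagrammatic order. -/
structure WCat (W : Type u) [Bicategory.{w, v} W] where
  ob : Type u₁
  ext : ob → W
  hom : ∀ a b, ext a ⟶ ext b
  id : ∀ a, 𝟙 (ext a) ⟶ hom a a
  comp : ∀ a b c, hom a b ≫ hom b c ⟶ hom a c
  id_comp : ∀ a b, id a ▷ hom a b ≫ comp a a b = (λ_ (hom a b)).hom
  comp_id : ∀ a b, hom a b ◁ id b ≫ comp a b b = (ρ_ (hom a b)).hom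
  assoc : ∀ a b c d, comp a b c ▷ hom c d ≫ comp a c d =
    (α_ (hom a b) (hom b c) (hom c d)).hom ≫ hom a b ◁ comp b c d ≫ comp a b d

/-- Small `W`-categories: the objects of the bicategory of modules. -/
abbrev WMod (W : Type u) [Bicategory.{w, v} W] := WCat.{w, v, u, w} W

/-- A profunctor `A ⇸ B` between small `W`-categories, with its actions of `A` and `B`.
The 1-cell `obj a b : ext a ⟶ ext b` is the component usually written `M(b, a)`. -/
structure WProf {W : Type u} [Bicategory.{w, v} W] (A B : WMod W) where
  obj : ∀ (a : A.ob) (b : B.ob), A.ext a ⟶ B.ext b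
  lact : ∀ a a' b, A.hom a a' ≫ obj a' b ⟶ obj a b
  ract : ∀ a b b', obj a b ≫ B.hom b b' ⟶ obj a b'
  id_lact : ∀ a b, A.id a ▷ obj a b ≫ lact a a b = (λ_ (obj a b)).hom
  comp_lact : ∀ a a' a'' b, A.comp a a' a'' ▷ obj a'' b ≫ lact a a'' b =
    (α_ (A.hom a a') (A.hom a' a'') (obj a'' b)).hom ≫ A.hom a a' ◁ lact a' a'' b ≫ lact a a' b
  ract_id : ∀ a b, obj a b ◁ B.id b ≫ ract a b b = (ρ_ (obj a b)).hom
  ract_ract : ∀ a b b' b'', ract a b b' ▷ B.hom b' b'' ≫ ract a b' b'' =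
    (α_ (obj a b) (B.hom b b') (B.hom b' b'')).hom ≫ obj a b ◁ B.comp b b' b'' ≫ ract a b b''
  lact_ract : ∀ a a' b b', lact a a' b ▷ B.hom b b' ≫ ract a b b' =
    (α_ (A.hom a a') (obj a' b) (B.hom b b')).hom ≫ A.hom a a' ◁ ract a' b b' ≫ lact a a' b'

/-- Maps of profunctors. -/
@[ext]
structure WProfHom {W : Type u} [Bicategory.{w, v} W] {A B : WMod W} (M N : WProf A B) where
  app : ∀ a b, M.obj a b ⟶ N.obj a b
  lact_app : ∀ a a' b, M.lact a a' b ≫ app a b = A.hom a a' ◁ app a' b ≫ N.lact a a' b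
  ract_app : ∀ a b b', M.ract a b b' ≫ app a b' = app a b ▷ B.hom b b' ≫ N.ract a b b'

section JointEpi

variable {D : Type u₁} [Category.{w} D] {D' : Type u₂} [Category.{w} D']

/-- A jointly epimorphic family of morphisms. -/
def JointEpi {I : Type w} {X : I → D} {S : D} (f : ∀ i, X i ⟶ S) : Prop :=
  ∀ ⦃T : D⦄ (g h : S ⟶ T), (∀ i, f i ≫ g = f i ≫ h) → g = h

theorem JointEpi.map {I : Type w} {X : I → D} {S : D} {f : ∀ i, X i ⟶ S} (hf : JointEpi f)
    (L : D ⥤ D') [L.IsLeftAdjoint] : JointEpi (fun i => L.map (f i)) := by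
  intro T g h H
  apply ((Adjunction.ofIsLeftAdjoint L).homEquiv _ _).injective
  apply hf
  intro i
  rw [← Adjunction.homEquiv_naturality_left, ← Adjunction.homEquiv_naturality_left, H i]

variable [HasColimits D] {I J : Type w} {X : I → D} {Y : J → D} {s t : J → I}
  (p : ∀ j, Y j ⟶ X (s j)) (q : ∀ j, Y j ⟶ X (t j))

/-- The coequaliser of the two maps `∐ Y ⇉ ∐ X` with components `p j` and `q j`. -/
noncomputable def sumCoeq : D :=
  coequalizer (Sigma.desc fun j => p j ≫ Sigma.ι X (s j)) (Sigma.desc fun j => q j ≫ Sigma.ι X (t j))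

/-- The coprojections into `sumCoeq`. -/
noncomputable def sumCoeqι (i : I) : X i ⟶ sumCoeq p q :=
  Sigma.ι X i ≫ coequalizer.π (Sigma.desc fun j => p j ≫ Sigma.ι X (s j))
    (Sigma.desc fun j => q j ≫ Sigma.ι X (t j))

theorem sumCoeq_condition (j : J) : p j ≫ sumCoeqι p q (s j) = q j ≫ sumCoeqι p q (t j) := by
  have h := Sigma.ι Y j ≫= coequalizer.condition (Sigma.desc fun j => p j ≫ Sigma.ι X (s j))
    (Sigma.desc fun j => q j ≫ Sigma.ι X (t j))
  rw [← Category.assoc, ← Category.assoc, Sigma.ι_desc, Sigma.ι_desc, Category.assoc,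
    Category.assoc] at h
  exact h

theorem sumCoeqι_jointEpi : JointEpi (sumCoeqι p q) := by
  intro T g h H
  refine coequalizer.hom_ext (Sigma.hom_ext _ _ fun i => ?_)
  have := H i
  unfold sumCoeqι at this
  erw [Category.assoc, Category.assoc] at this
  exact this

theorem sumCoeq_desc' {T : D} (f : ∀ i, X i ⟶ T) (hf : ∀ j, p j ≫ f (s j) = q j ≫ f (t j)) :
    ∃ g : sumCoeq p q ⟶ T, ∀ i, sumCoeqι p q i ≫ g = f i := by
  refine ⟨coequalizer.desc (Sigma.desc f) (Sigma.hom_ext _ _ fun j => ?_), fun i => ?_⟩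
  · rw [← Category.assoc, ← Category.assoc, Sigma.ι_desc, Sigma.ι_desc, Category.assoc,
      Category.assoc, Sigma.ι_desc, Sigma.ι_desc, hf]
  · unfold sumCoeqι
    erw [Category.assoc, coequalizer.π_desc, Sigma.ι_desc]

/-- Left adjoints preserve the universal property of `sumCoeq`. -/
theorem sumCoeq_desc (L : D ⥤ D') [L.IsLeftAdjoint] {T : D'} (f : ∀ i, L.obj (X i) ⟶ T)
    (hf : ∀ j, L.map (p j) ≫ f (s j) = L.map (q j) ≫ f (t j)) :
    ∃ g : L.obj (sumCoeq p q) ⟶ T, ∀ i, L.map (sumCoeqι p q i) ≫ g = f i := by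
  let adj := Adjunction.ofIsLeftAdjoint L
  obtain ⟨g, hg⟩ := sumCoeq_desc' p q (fun i => adj.homEquiv _ _ (f i)) (fun j => by
    rw [← Adjunction.homEquiv_naturality_left, ← Adjunction.homEquiv_naturality_left, hf])
  refine ⟨(adj.homEquiv _ _).symm g, fun i => ?_⟩
  rw [← Adjunction.homEquiv_naturality_left_symm, hg, Equiv.symm_apply_apply]

end JointEpi

namespace WProf

variable {W : Type u} [Bicategory.{w, v} W]

instance category (A B : WMod W) : Category.{w} (WProf A B) where
  Hom := WProfHom
  id M :=
    { app := fun a b => 𝟙 _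
      lact_app := by intros; simp
      ract_app := by intros; simp }
  comp {M N P} f g :=
    { app := fun a b => f.app a b ≫ g.app a b
      lact_app := by
        intro a a' b
        rw [← Category.assoc, f.lact_app, Category.assoc, g.lact_app, whiskerLeft_comp,
          Category.assoc]
      ract_app := by
        intro a b b'
        rw [← Category.assoc, f.ract_app, Category.assoc, g.ract_app, comp_whiskerRight,
          Category.assoc] }

@[ext]
theorem hom_ext {A B : WMod W} {M N : WProf A B} {f g : M ⟶ N}
    (h : ∀ a b, f.app a b = g.app a b) : f = g :=
  WProfHom.ext (funext fun a => funext fun b => h a b)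

@[simp]
theorem id_app {A B : WMod W} (M : WProf A B) (a b) : WProfHom.app (𝟙 M) a b = 𝟙 (M.obj a b) :=
  rfl

@[simp]
theorem comp_app {A B : WMod W} {M N P : WProf A B} (f : M ⟶ N) (g : N ⟶ P) (a b) :
    WProfHom.app (f ≫ g) a b = f.app a b ≫ g.app a b := rfl

/-- The identity profunctor, given by the hom-objects. -/
abbrev idProf (A : WMod W) : WProf A A where
  obj := A.hom
  lact := A.comp
  ract := A.comp
  id_lact := A.id_comp
  comp_lact := A.assoc
  ract_id := A.comp_id
  ract_ract := A.assoc
  lact_ract := A.assoc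

theorem whisker_assoc_symm_aux {x y z t : W} {X : x ⟶ y} {P Q : y ⟶ z} (f : P ⟶ Q) {Y : z ⟶ t}
    {T : x ⟶ t} (g : (X ≫ Q) ≫ Y ⟶ T) :
    (α_ X P Y).inv ≫ (X ◁ f) ▷ Y ≫ g = X ◁ f ▷ Y ≫ (α_ X Q Y).inv ≫ g := by simp

variable [BiclosedBicategory W] {A B C D E : WMod W}

section Tensor

variable (M : WProf A B) (N : WProf B C)

/-- The component of the tensor product over `B` of `M` and `N`: the coequaliser of the two maps
`∑ M a b ≫ B b b' ≫ N b' c ⇉ ∑ M a b ≫ N b c` given by the actions of `B` on `N` and on `M`. -/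
noncomputable def tensorObj (a : A.ob) (c : C.ob) : A.ext a ⟶ C.ext c :=
  sumCoeq (I := B.ob) (J := B.ob × B.ob) (X := fun b => M.obj a b ≫ N.obj b c)
    (Y := fun j => M.obj a j.1 ≫ B.hom j.1 j.2 ≫ N.obj j.2 c) (s := Prod.fst) (t := Prod.snd)
    (fun j => M.obj a j.1 ◁ N.lact j.1 j.2 c)
    (fun j => (α_ _ _ _).inv ≫ M.ract a j.1 j.2 ▷ N.obj j.2 c)

/-- The universal balanced family. -/
noncomputable def tι (a : A.ob) (b : B.ob) (c : C.ob) :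
    M.obj a b ≫ N.obj b c ⟶ tensorObj M N a c :=
  sumCoeqι (I := B.ob) (J := B.ob × B.ob) (X := fun b => M.obj a b ≫ N.obj b c)
    (Y := fun j => M.obj a j.1 ≫ B.hom j.1 j.2 ≫ N.obj j.2 c) (s := Prod.fst) (t := Prod.snd) _ _ b

theorem tι_balanced (a : A.ob) (b b' : B.ob) (c : C.ob) :
    M.ract a b b' ▷ N.obj b' c ≫ tι M N a b' c =
      (α_ _ _ _).hom ≫ M.obj a b ◁ N.lact b b' c ≫ tι M N a b c := by
  rw [← Iso.inv_comp_eq, ← Category.assoc]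
  exact (sumCoeq_condition (I := B.ob) (J := B.ob × B.ob) (X := fun b => M.obj a b ≫ N.obj b c)
    (Y := fun j => M.obj a j.1 ≫ B.hom j.1 j.2 ≫ N.obj j.2 c) (s := Prod.fst) (t := Prod.snd)
    (fun j => M.obj a j.1 ◁ N.lact j.1 j.2 c)
    (fun j => (α_ _ _ _).inv ≫ M.ract a j.1 j.2 ▷ N.obj j.2 c) (b, b')).symm

theorem tι_jointEpi (a : A.ob) (c : C.ob) : JointEpi fun b => tι M N a b c :=
  sumCoeqι_jointEpi _ _

theorem tensor_desc {D : Type v} [Category.{w} D] (a : A.ob) (c : C.ob)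
    (L : (A.ext a ⟶ C.ext c) ⥤ D) [L.IsLeftAdjoint] {T : D}
    (f : ∀ b, L.obj (M.obj a b ≫ N.obj b c) ⟶ T)
    (hf : ∀ b b', L.map (M.ract a b b' ▷ N.obj b' c) ≫ f b' =
      L.map (α_ _ _ _).hom ≫ L.map (M.obj a b ◁ N.lact b b' c) ≫ f b) :
    ∃ g : L.obj (tensorObj M N a c) ⟶ T, ∀ b, L.map (tι M N a b c) ≫ g = f b := by
  refine sumCoeq_desc (I := B.ob) (J := B.ob × B.ob) (X := fun b => M.obj a b ≫ N.obj b c)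
    (Y := fun j => M.obj a j.1 ≫ B.hom j.1 j.2 ≫ N.obj j.2 c) (s := Prod.fst) (t := Prod.snd)
    _ _ L f (fun j => ?_)
  rw [L.map_comp, Category.assoc, hf, ← Category.assoc, ← L.map_comp, Iso.inv_hom_id, L.map_id,
    Category.id_comp]

theorem exists_tdesc {a : A.ob} {c : C.ob} {T : A.ext a ⟶ C.ext c}
    (f : ∀ b, M.obj a b ≫ N.obj b c ⟶ T)
    (hf : ∀ b b', M.ract a b b' ▷ N.obj b' c ≫ f b' =
      (α_ _ _ _).hom ≫ M.obj a b ◁ N.lact b b' c ≫ f b) :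
    ∃ g : tensorObj M N a c ⟶ T, ∀ b, tι M N a b c ≫ g = f b :=
  tensor_desc M N a c (𝟭 _) f hf

theorem exists_tdescL {a : A.ob} {c : C.ob} {x : W} (X : x ⟶ A.ext a) {T : x ⟶ C.ext c}
    (f : ∀ b, X ≫ M.obj a b ≫ N.obj b c ⟶ T)
    (hf : ∀ b b', X ◁ M.ract a b b' ▷ N.obj b' c ≫ f b' =
      X ◁ (α_ _ _ _).hom ≫ X ◁ M.obj a b ◁ N.lact b b' c ≫ f b) :
    ∃ g : X ≫ tensorObj M N a c ⟶ T, ∀ b, X ◁ tι M N a b c ≫ g = f b :=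
  tensor_desc M N a c (precomp _ X) f hf

theorem exists_tdescR {a : A.ob} {c : C.ob} {y : W} (Y : C.ext c ⟶ y) {T : A.ext a ⟶ y}
    (f : ∀ b, (M.obj a b ≫ N.obj b c) ≫ Y ⟶ T)
    (hf : ∀ b b', M.ract a b b' ▷ N.obj b' c ▷ Y ≫ f b' =
      (α_ _ _ _).hom ▷ Y ≫ (M.obj a b ◁ N.lact b b' c) ▷ Y ≫ f b) :
    ∃ g : tensorObj M N a c ≫ Y ⟶ T, ∀ b, tι M N a b c ▷ Y ≫ g = f b :=
  tensor_desc M N a c (postcomp _ Y) f hf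

/-- The map out of the tensor product induced by a balanced family. -/
noncomputable def tdesc {a : A.ob} {c : C.ob} {T : A.ext a ⟶ C.ext c}
    (f : ∀ b, M.obj a b ≫ N.obj b c ⟶ T)
    (hf : ∀ b b', M.ract a b b' ▷ N.obj b' c ≫ f b' =
      (α_ _ _ _).hom ≫ M.obj a b ◁ N.lact b b' c ≫ f b) : tensorObj M N a c ⟶ T :=
  (exists_tdesc M N f hf).choose

theorem tι_tdesc {a : A.ob} {c : C.ob} {T : A.ext a ⟶ C.ext c}
    (f : ∀ b, M.obj a b ≫ N.obj b c ⟶ T) (hf) (b : B.ob) :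
    tι M N a b c ≫ tdesc M N f hf = f b :=
  (exists_tdesc M N f hf).choose_spec b

/-- The map out of the left-whiskered tensor product induced by a balanced family. -/
noncomputable def tdescL {a : A.ob} {c : C.ob} {x : W} (X : x ⟶ A.ext a) {T : x ⟶ C.ext c}
    (f : ∀ b, X ≫ M.obj a b ≫ N.obj b c ⟶ T)
    (hf : ∀ b b', X ◁ M.ract a b b' ▷ N.obj b' c ≫ f b' =
      X ◁ (α_ _ _ _).hom ≫ X ◁ M.obj a b ◁ N.lact b b' c ≫ f b) : X ≫ tensorObj M N a c ⟶ T :=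
  (exists_tdescL M N X f hf).choose

theorem tι_tdescL {a : A.ob} {c : C.ob} {x : W} (X : x ⟶ A.ext a) {T : x ⟶ C.ext c}
    (f : ∀ b, X ≫ M.obj a b ≫ N.obj b c ⟶ T) (hf) (b : B.ob) :
    X ◁ tι M N a b c ≫ tdescL M N X f hf = f b :=
  (exists_tdescL M N X f hf).choose_spec b

/-- The map out of the right-whiskered tensor product induced by a balanced family. -/
noncomputable def tdescR {a : A.ob} {c : C.ob} {y : W} (Y : C.ext c ⟶ y) {T : A.ext a ⟶ y}
    (f : ∀ b, (M.obj a b ≫ N.obj b c) ≫ Y ⟶ T)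
    (hf : ∀ b b', M.ract a b b' ▷ N.obj b' c ▷ Y ≫ f b' =
      (α_ _ _ _).hom ▷ Y ≫ (M.obj a b ◁ N.lact b b' c) ▷ Y ≫ f b) : tensorObj M N a c ≫ Y ⟶ T :=
  (exists_tdescR M N Y f hf).choose

theorem tι_tdescR {a : A.ob} {c : C.ob} {y : W} (Y : C.ext c ⟶ y) {T : A.ext a ⟶ y}
    (f : ∀ b, (M.obj a b ≫ N.obj b c) ≫ Y ⟶ T) (hf) (b : B.ob) :
    tι M N a b c ▷ Y ≫ tdescR M N Y f hf = f b :=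
  (exists_tdescR M N Y f hf).choose_spec b

variable {M N}

theorem t_ext {a : A.ob} {c : C.ob} {T : A.ext a ⟶ C.ext c} {g h : tensorObj M N a c ⟶ T}
    (H : ∀ b, tι M N a b c ≫ g = tι M N a b c ≫ h) : g = h :=
  tι_jointEpi M N a c g h H

theorem t_extL {a : A.ob} {c : C.ob} {x : W} {X : x ⟶ A.ext a} {T : x ⟶ C.ext c}
    {g h : X ≫ tensorObj M N a c ⟶ T}
    (H : ∀ b, X ◁ tι M N a b c ≫ g = X ◁ tι M N a b c ≫ h) : g = h :=
  (tι_jointEpi M N a c).map (precomp _ X) g h H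

theorem t_extR {a : A.ob} {c : C.ob} {y : W} {Y : C.ext c ⟶ y} {T : A.ext a ⟶ y}
    {g h : tensorObj M N a c ≫ Y ⟶ T}
    (H : ∀ b, tι M N a b c ▷ Y ≫ g = tι M N a b c ▷ Y ≫ h) : g = h :=
  (tι_jointEpi M N a c).map (postcomp _ Y) g h H

theorem t_extLR {a : A.ob} {c : C.ob} {x y : W} {X : x ⟶ A.ext a} {Y : C.ext c ⟶ y} {T : x ⟶ y}
    {g h : X ≫ tensorObj M N a c ≫ Y ⟶ T}
    (H : ∀ b, X ◁ tι M N a b c ▷ Y ≫ g = X ◁ tι M N a b c ▷ Y ≫ h) : g = h :=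
  ((tι_jointEpi M N a c).map (postcomp _ Y)).map (precomp _ X) g h H

variable (M N)

/-- The action of `A` on the tensor product, inherited from `M`. -/
noncomputable def tlact (a a' : A.ob) (c : C.ob) :
    A.hom a a' ≫ tensorObj M N a' c ⟶ tensorObj M N a c :=
  tdescL M N (A.hom a a') (fun b => (α_ _ _ _).inv ≫ M.lact a a' b ▷ N.obj b c ≫ tι M N a b c)
    (fun b b' => by
      have h2 : M.lact a a' b ▷ B.hom b b' ▷ N.obj b' c ≫ M.ract a b b' ▷ N.obj b' c =
          (α_ _ _ _).hom ▷ _ ≫ (A.hom a a' ◁ M.ract a' b b') ▷ _ ≫ M.lact a a' b' ▷ _ := by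
        rw [← comp_whiskerRight, M.lact_ract, comp_whiskerRight, comp_whiskerRight]
      have h3 := tι_balanced M N a b b' c
      rw [← whisker_assoc_symm_aux, Iso.inv_comp_eq,
        ← cancel_epi ((α_ (A.hom a a') (M.obj a' b) (B.hom b b')).hom ▷ N.obj b' c),
        ← reassoc_of% h2, h3, associator_naturality_left_assoc, ← whisker_exchange_assoc]
      simp)

theorem tι_tlact (a a' : A.ob) (b : B.ob) (c : C.ob) :
    A.hom a a' ◁ tι M N a' b c ≫ tlact M N a a' c =
      (α_ _ _ _).inv ≫ M.lact a a' b ▷ N.obj b c ≫ tι M N a b c :=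
  tι_tdescL M N _ _ _ b

/-- The action of `C` on the tensor product, inherited from `N`. -/
noncomputable def tract (a : A.ob) (c c' : C.ob) :
    tensorObj M N a c ≫ C.hom c c' ⟶ tensorObj M N a c' :=
  tdescR M N (C.hom c c') (fun b => (α_ _ _ _).hom ≫ M.obj a b ◁ N.ract b c c' ≫ tι M N a b c')
    (fun b b' => by
      have h2 := congrArg (M.obj a b ◁ ·) (N.lact_ract b b' c c')
      simp only [whiskerLeft_comp] at h2
      have h3 := tι_balanced M N a b b' c'
      rw [associator_naturality_left_assoc, ← whisker_exchange_assoc, h3]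
      simp [reassoc_of% h2])

theorem tι_tract (a : A.ob) (b : B.ob) (c c' : C.ob) :
    tι M N a b c ▷ C.hom c c' ≫ tract M N a c c' =
      (α_ _ _ _).hom ≫ M.obj a b ◁ N.ract b c c' ≫ tι M N a b c' :=
  tι_tdescR M N _ _ _ b

/-- The tensor product over `B` of the profunctors `M : A ⇸ B` and `N : B ⇸ C`. -/
noncomputable def tensor : WProf A C where
  obj := tensorObj M N
  lact := tlact M N
  ract := tract M N
  id_lact a c := t_extL fun b => by
    have h := congrArg (· ▷ N.obj b c) (M.id_lact a b)
    simp only [comp_whiskerRight] at h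
    rw [whisker_exchange_assoc, tι_tlact]
    simp [reassoc_of% h]
  comp_lact a a' a'' c := t_extL fun b => by
    have h := congrArg (· ▷ N.obj b c) (M.comp_lact a a' a'' b)
    simp only [comp_whiskerRight] at h
    rw [whisker_exchange_assoc, tι_tlact]
    have h1 := tι_tlact M N a a' b c
    have h2 := congrArg (A.hom a a' ◁ ·) (tι_tlact M N a' a'' b c)
    simp only [whiskerLeft_comp] at h2
    simp [reassoc_of% h, reassoc_of% h2, h1]
  ract_id a c := t_extR fun b => by
    have h := congrArg (M.obj a b ◁ ·) (N.ract_id b c)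
    simp only [whiskerLeft_comp] at h
    rw [← whisker_exchange_assoc, tι_tract]
    simp [reassoc_of% h]
  ract_ract a c c' c'' := by
    rw [← Iso.inv_comp_eq]
    refine t_extR fun b => ?_
    have h := congrArg (M.obj a b ◁ ·) (N.ract_ract b c c' c'')
    simp only [whiskerLeft_comp] at h
    have h1 : tι M N a b c ▷ C.hom c c' ▷ C.hom c' c'' ≫ tract M N a c c' ▷ C.hom c' c'' =
      (α_ _ _ _).hom ▷ _ ≫ (M.obj a b ◁ N.ract b c c') ▷ _ ≫ tι M N a b c' ▷ _ := by
      rw [← comp_whiskerRight, tι_tract, comp_whiskerRight, comp_whiskerRight]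
    have h2 := tι_tract M N a b c' c''
    rw [← whisker_exchange_assoc, tι_tract]
    simp [reassoc_of% h, reassoc_of% h1, h2]
  lact_ract a a' c c' := by
    rw [← Iso.inv_comp_eq]
    refine t_extLR fun b => ?_
    have h1 := tι_tract M N a b c c'
    have h2 := tι_tlact M N a a' b c'
    have h3 := congrArg (A.hom a a' ◁ ·) (tι_tract M N a' b c c')
    simp only [whiskerLeft_comp] at h3
    have h4 : (A.hom a a' ◁ tι M N a' b c) ▷ C.hom c c' ≫ tlact M N a a' c ▷ C.hom c c' =
      (α_ _ _ _).inv ▷ _ ≫ M.lact a a' b ▷ N.obj b c ▷ _ ≫ tι M N a b c ▷ _ := by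
      rw [← comp_whiskerRight, tι_tlact, comp_whiskerRight, comp_whiskerRight]
    rw [reassoc_of% h3, h2, ← whisker_assoc_symm_aux, reassoc_of% h4, h1,
      associator_naturality_left_assoc, ← whisker_exchange_assoc]
    simp

/-- The universal balanced family, with values in the tensor product. -/
noncomputable def ι (a : A.ob) (b : B.ob) (c : C.ob) :
    M.obj a b ≫ N.obj b c ⟶ (tensor M N).obj a c :=
  tι M N a b c

theorem ι_balanced (a : A.ob) (b b' : B.ob) (c : C.ob) :
    M.ract a b b' ▷ N.obj b' c ≫ ι M N a b' c =
      (α_ _ _ _).hom ≫ M.obj a b ◁ N.lact b b' c ≫ ι M N a b c :=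
  tι_balanced M N a b b' c

theorem ι_lact (a a' : A.ob) (b : B.ob) (c : C.ob) :
    A.hom a a' ◁ ι M N a' b c ≫ (tensor M N).lact a a' c =
      (α_ _ _ _).inv ≫ M.lact a a' b ▷ N.obj b c ≫ ι M N a b c :=
  tι_tlact M N a a' b c

theorem ι_ract (a : A.ob) (b : B.ob) (c c' : C.ob) :
    ι M N a b c ▷ C.hom c c' ≫ (tensor M N).ract a c c' =
      (α_ _ _ _).hom ≫ M.obj a b ◁ N.ract b c c' ≫ ι M N a b c' :=
  tι_tract M N a b c c'

/-- The map out of a component of the tensor product induced by a balanced family. -/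
noncomputable def desc {a : A.ob} {c : C.ob} {T : A.ext a ⟶ C.ext c}
    (f : ∀ b, M.obj a b ≫ N.obj b c ⟶ T)
    (hf : ∀ b b', M.ract a b b' ▷ N.obj b' c ≫ f b' =
      (α_ _ _ _).hom ≫ M.obj a b ◁ N.lact b b' c ≫ f b) : (tensor M N).obj a c ⟶ T :=
  tdesc M N f hf

theorem ι_desc {a : A.ob} {c : C.ob} {T : A.ext a ⟶ C.ext c}
    (f : ∀ b, M.obj a b ≫ N.obj b c ⟶ T) (hf) (b : B.ob) :
    ι M N a b c ≫ desc M N f hf = f b :=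
  tι_tdesc M N f hf b

/-- The map out of a left-whiskered component induced by a balanced family. -/
noncomputable def descL {a : A.ob} {c : C.ob} {x : W} (X : x ⟶ A.ext a) {T : x ⟶ C.ext c}
    (f : ∀ b, X ≫ M.obj a b ≫ N.obj b c ⟶ T)
    (hf : ∀ b b', X ◁ M.ract a b b' ▷ N.obj b' c ≫ f b' =
      X ◁ (α_ _ _ _).hom ≫ X ◁ M.obj a b ◁ N.lact b b' c ≫ f b) :
    X ≫ (tensor M N).obj a c ⟶ T :=
  tdescL M N X f hf

theorem ι_descL {a : A.ob} {c : C.ob} {x : W} (X : x ⟶ A.ext a) {T : x ⟶ C.ext c}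
    (f : ∀ b, X ≫ M.obj a b ≫ N.obj b c ⟶ T) (hf) (b : B.ob) :
    X ◁ ι M N a b c ≫ descL M N X f hf = f b :=
  tι_tdescL M N X f hf b

/-- The map out of a right-whiskered component induced by a balanced family. -/
noncomputable def descR {a : A.ob} {c : C.ob} {y : W} (Y : C.ext c ⟶ y) {T : A.ext a ⟶ y}
    (f : ∀ b, (M.obj a b ≫ N.obj b c) ≫ Y ⟶ T)
    (hf : ∀ b b', M.ract a b b' ▷ N.obj b' c ▷ Y ≫ f b' =
      (α_ _ _ _).hom ▷ Y ≫ (M.obj a b ◁ N.lact b b' c) ▷ Y ≫ f b) :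
    (tensor M N).obj a c ≫ Y ⟶ T :=
  tdescR M N Y f hf

theorem ι_descR {a : A.ob} {c : C.ob} {y : W} (Y : C.ext c ⟶ y) {T : A.ext a ⟶ y}
    (f : ∀ b, (M.obj a b ≫ N.obj b c) ≫ Y ⟶ T) (hf) (b : B.ob) :
    ι M N a b c ▷ Y ≫ descR M N Y f hf = f b :=
  tι_tdescR M N Y f hf b

variable {M N}

theorem ι_ext {a : A.ob} {c : C.ob} {T : A.ext a ⟶ C.ext c} {g h : (tensor M N).obj a c ⟶ T}
    (H : ∀ b, ι M N a b c ≫ g = ι M N a b c ≫ h) : g = h :=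
  tι_jointEpi M N a c g h H

theorem ι_extL {a : A.ob} {c : C.ob} {x : W} {X : x ⟶ A.ext a} {T : x ⟶ C.ext c}
    {g h : X ≫ (tensor M N).obj a c ⟶ T}
    (H : ∀ b, X ◁ ι M N a b c ≫ g = X ◁ ι M N a b c ≫ h) : g = h :=
  t_extL H

theorem ι_extR {a : A.ob} {c : C.ob} {y : W} {Y : C.ext c ⟶ y} {T : A.ext a ⟶ y}
    {g h : (tensor M N).obj a c ≫ Y ⟶ T}
    (H : ∀ b, ι M N a b c ▷ Y ≫ g = ι M N a b c ▷ Y ≫ h) : g = h :=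
  t_extR H

theorem ι_extLR {a : A.ob} {c : C.ob} {x y : W} {X : x ⟶ A.ext a} {Y : C.ext c ⟶ y} {T : x ⟶ y}
    {g h : X ≫ (tensor M N).obj a c ≫ Y ⟶ T}
    (H : ∀ b, X ◁ ι M N a b c ▷ Y ≫ g = X ◁ ι M N a b c ▷ Y ≫ h) : g = h :=
  t_extLR H

/-- The profunctor map out of a tensor product induced by a family of 2-cells that is balanced
over `B` and compatible with the outer actions. -/
noncomputable def tensorHom {L : WProf A C} (f : ∀ a b c, M.obj a b ≫ N.obj b c ⟶ L.obj a c)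
    (hf : ∀ a b b' c, M.ract a b b' ▷ N.obj b' c ≫ f a b' c =
      (α_ _ _ _).hom ≫ M.obj a b ◁ N.lact b b' c ≫ f a b c)
    (hl : ∀ a a' b c, M.lact a a' b ▷ N.obj b c ≫ f a b c =
      (α_ _ _ _).hom ≫ A.hom a a' ◁ f a' b c ≫ L.lact a a' c)
    (hr : ∀ a b c c', f a b c ▷ C.hom c c' ≫ L.ract a c c' =
      (α_ _ _ _).hom ≫ M.obj a b ◁ N.ract b c c' ≫ f a b c') : tensor M N ⟶ L where
  app a c := desc M N (fun b => f a b c) (fun b b' => hf a b b' c)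
  lact_app a a' c := ι_extL fun b => by
    have h1 := ι_desc M N (fun b => f a b c) (fun b b' => hf a b b' c) b
    have h2 := congrArg (A.hom a a' ◁ ·)
      (ι_desc M N (fun b => f a' b c) (fun b b' => hf a' b b' c) b)
    simp only [whiskerLeft_comp] at h2
    rw [reassoc_of% (ι_lact M N a a' b c), h1, reassoc_of% h2, hl, Iso.inv_hom_id_assoc]
  ract_app a c c' := ι_extR fun b => by
    have h1 := ι_desc M N (fun b => f a b c') (fun b b' => hf a b b' c') b
    have h2 := congrArg (· ▷ C.hom c c')
      (ι_desc M N (fun b => f a b c) (fun b b' => hf a b b' c) b)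
    simp only [comp_whiskerRight] at h2
    rw [reassoc_of% (ι_ract M N a b c c'), h1, reassoc_of% h2, hr]

theorem ι_tensorHom {L : WProf A C} (f : ∀ a b c, M.obj a b ≫ N.obj b c ⟶ L.obj a c)
    (hf hl hr) (a : A.ob) (b : B.ob) (c : C.ob) :
    ι M N a b c ≫ (tensorHom (L := L) f hf hl hr).app a c = f a b c :=
  ι_desc M N (fun b => f a b c) (fun b b' => hf a b b' c) b

theorem tensor_hom_ext {L : WProf A C} {f g : tensor M N ⟶ L}
    (h : ∀ a b c, ι M N a b c ≫ f.app a c = ι M N a b c ≫ g.app a c) : f = g :=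
  hom_ext fun a c => ι_ext fun b => h a b c

end Tensor

/-- A profunctor map with invertible components is invertible. -/
@[simps]
def isoMk {M N : WProf A B} (f : M ⟶ N) (g : ∀ a b, N.obj a b ⟶ M.obj a b)
    (h₁ : ∀ a b, f.app a b ≫ g a b = 𝟙 _) (h₂ : ∀ a b, g a b ≫ f.app a b = 𝟙 _) : M ≅ N where
  hom := f
  inv :=
    { app := g
      lact_app := fun a a' b => by
        have h : A.hom a a' ◁ g a' b ≫ A.hom a a' ◁ f.app a' b = 𝟙 _ := by
          rw [← whiskerLeft_comp, h₂, whiskerLeft_id]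
        rw [← Category.id_comp (N.lact a a' b), ← h, Category.assoc, Category.assoc,
          ← reassoc_of% (f.lact_app a a' b), h₁]
        simp
      ract_app := fun a b b' => by
        have h : g a b ▷ B.hom b b' ≫ f.app a b ▷ B.hom b b' = 𝟙 _ := by
          rw [← comp_whiskerRight, h₂, id_whiskerRight]
        rw [← Category.id_comp (N.ract a b b'), ← h, Category.assoc, Category.assoc,
          ← reassoc_of% (f.ract_app a b b'), h₁]
        simp }
  hom_inv_id := hom_ext h₁
  inv_hom_id := hom_ext h₂

section Whisker

/-- Left whiskering: the tensor product of the identity of `M` with `g`. -/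
noncomputable def whiskerL (M : WProf A B) {N N' : WProf B C} (g : N ⟶ N') :
    tensor M N ⟶ tensor M N' :=
  tensorHom (fun a b c => M.obj a b ◁ g.app b c ≫ ι M N' a b c)
    (fun a b b' c => by
      have h := congrArg (M.obj a b ◁ ·) (g.lact_app b b' c)
      simp only [whiskerLeft_comp] at h
      rw [reassoc_of% h, ← whisker_exchange_assoc, ι_balanced]
      simp)
    (fun a a' b c => by
      rw [← whisker_exchange_assoc]
      simp [ι_lact])
    (fun a b c c' => by
      have h := congrArg (M.obj a b ◁ ·) (g.ract_app b c c')
      simp only [whiskerLeft_comp] at h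
      simp [ι_ract, reassoc_of% h])

theorem ι_whiskerL (M : WProf A B) {N N' : WProf B C} (g : N ⟶ N') (a : A.ob) (b : B.ob)
    (c : C.ob) : ι M N a b c ≫ (whiskerL M g).app a c = M.obj a b ◁ g.app b c ≫ ι M N' a b c :=
  ι_tensorHom _ _ _ _ a b c

/-- Right whiskering: the tensor product of `f` with the identity of `N`. -/
noncomputable def whiskerR {M M' : WProf A B} (f : M ⟶ M') (N : WProf B C) :
    tensor M N ⟶ tensor M' N :=
  tensorHom (fun a b c => f.app a b ▷ N.obj b c ≫ ι M' N a b c)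
    (fun a b b' c => by
      have h := congrArg (· ▷ N.obj b' c) (f.ract_app a b b')
      simp only [comp_whiskerRight] at h
      rw [reassoc_of% h, whisker_exchange_assoc, ι_balanced]
      simp)
    (fun a a' b c => by
      have h := congrArg (· ▷ N.obj b c) (f.lact_app a a' b)
      simp only [comp_whiskerRight] at h
      simp [ι_lact, reassoc_of% h])
    (fun a b c c' => by
      rw [whisker_exchange_assoc]
      simp [ι_ract])

theorem ι_whiskerR {M M' : WProf A B} (f : M ⟶ M') (N : WProf B C) (a : A.ob) (b : B.ob)
    (c : C.ob) : ι M N a b c ≫ (whiskerR f N).app a c = f.app a b ▷ N.obj b c ≫ ι M' N a b c :=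
  ι_tensorHom _ _ _ _ a b c

end Whisker

section Unitors

variable (M : WProf A B)

/-- The left unitor as a map, induced by the action of `A`. -/
noncomputable def lUnitorHom : tensor (idProf A) M ⟶ M :=
  tensorHom (fun a a' b => M.lact a a' b) (fun a a' a'' b => M.comp_lact a a' a'' b)
    (fun a a' a'' b => M.comp_lact a a' a'' b) (fun a a' b b' => M.lact_ract a a' b b')

theorem ι_lUnitorHom (a a' : A.ob) (b : B.ob) :
    ι (idProf A) M a a' b ≫ (lUnitorHom M).app a b = M.lact a a' b :=
  ι_tensorHom (M := idProf A) (N := M) (L := M) (fun a a' b => M.lact a a' b)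
    (fun a a' a'' b => M.comp_lact a a' a'' b)
    (fun a a' a'' b => M.comp_lact a a' a'' b) (fun a a' b b' => M.lact_ract a a' b b') a a' b

/-- The left unitor. -/
noncomputable def lUnitor : tensor (idProf A) M ≅ M :=
  isoMk (lUnitorHom M)
    (fun a b => (λ_ _).inv ≫ A.id a ▷ M.obj a b ≫ ι (idProf A) M a a b)
    (fun a b => ι_ext fun a' => by
      have h := ι_balanced (idProf A) M a a a' b
      rw [← Iso.inv_comp_eq] at h
      rw [← Category.assoc, ι_lUnitorHom, leftUnitor_inv_naturality_assoc, whisker_exchange_assoc]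
      have h' := congrArg (· ▷ M.obj a' b) (A.id_comp a a')
      simp only [comp_whiskerRight] at h'
      rw [← h]
      simp [reassoc_of% h'])
    (fun a b => by
      rw [Category.assoc, Category.assoc, ι_lUnitorHom, M.id_lact, Iso.inv_hom_id])

theorem ι_lUnitor (a a' : A.ob) (b : B.ob) :
    ι (idProf A) M a a' b ≫ (lUnitor M).hom.app a b = M.lact a a' b :=
  ι_lUnitorHom M a a' b

/-- The right unitor as a map, induced by the action of `B`. -/
noncomputable def rUnitorHom : tensor M (idProf B) ⟶ M :=
  tensorHom (fun a b b' => M.ract a b b') (fun a b b' b'' => M.ract_ract a b b' b'')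
    (fun a a' b b' => M.lact_ract a a' b b') (fun a b b' b'' => M.ract_ract a b b' b'')

theorem ι_rUnitorHom (a : A.ob) (b b' : B.ob) :
    ι M (idProf B) a b b' ≫ (rUnitorHom M).app a b' = M.ract a b b' :=
  ι_tensorHom (M := M) (N := idProf B) (L := M) (fun a b b' => M.ract a b b')
    (fun a b b' b'' => M.ract_ract a b b' b'') (fun a a' b b' => M.lact_ract a a' b b')
    (fun a b b' b'' => M.ract_ract a b b' b'') a b b'

/-- The right unitor. -/
noncomputable def rUnitor : tensor M (idProf B) ≅ M :=
  isoMk (rUnitorHom M)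
    (fun a b => (ρ_ _).inv ≫ M.obj a b ◁ B.id b ≫ ι M (idProf B) a b b)
    (fun a b' => ι_ext fun b => by
      have h := ι_balanced M (idProf B) a b b' b'
      rw [← Category.assoc, ι_rUnitorHom, rightUnitor_inv_naturality_assoc, ← whisker_exchange_assoc]
      have h' := congrArg (M.obj a b ◁ ·) (B.comp_id b b')
      simp only [whiskerLeft_comp] at h'
      simp [h, reassoc_of% h'])
    (fun a b => by
      rw [Category.assoc, Category.assoc, ι_rUnitorHom, M.ract_id, Iso.inv_hom_id])

theorem ι_rUnitor (a : A.ob) (b b' : B.ob) :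
    ι M (idProf B) a b b' ≫ (rUnitor M).hom.app a b' = M.ract a b b' :=
  ι_rUnitorHom M a b b'

end Unitors

section Associator

variable (M : WProf A B) (N : WProf B C) (P : WProf C D)

/-- Auxiliary map for the associator. -/
noncomputable def assocAux (a : A.ob) (c : C.ob) (d : D.ob) :
    (tensor M N).obj a c ≫ P.obj c d ⟶ (tensor M (tensor N P)).obj a d :=
  descR M N (P.obj c d)
    (fun b => (α_ _ _ _).hom ≫ M.obj a b ◁ ι N P b c d ≫ ι M (tensor N P) a b d)
    (fun b b' => by
      have h := congrArg (M.obj a b ◁ ·) (ι_lact N P b b' c d)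
      simp only [whiskerLeft_comp] at h
      rw [associator_naturality_left_assoc, ← whisker_exchange_assoc, ι_balanced]
      simp [reassoc_of% h])

theorem ι_assocAux (a : A.ob) (b : B.ob) (c : C.ob) (d : D.ob) :
    ι M N a b c ▷ P.obj c d ≫ assocAux M N P a c d =
      (α_ _ _ _).hom ≫ M.obj a b ◁ ι N P b c d ≫ ι M (tensor N P) a b d :=
  ι_descR M N (P.obj c d) _ _ b

/-- The associator, as a map. -/
noncomputable def assocHom : tensor (tensor M N) P ⟶ tensor M (tensor N P) :=
  tensorHom (assocAux M N P)
    (fun a c c' d => by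
      rw [← Iso.inv_comp_eq]
      refine ι_extR fun b => ?_
      have h1 := congrArg (· ▷ P.obj c' d) (ι_ract M N a b c c')
      simp only [comp_whiskerRight] at h1
      have h2 := congrArg (M.obj a b ◁ ·) (ι_balanced N P b c c' d)
      simp only [whiskerLeft_comp] at h2
      have h3 := ι_assocAux M N P a b c d
      have h4 := ι_assocAux M N P a b c' d
      rw [← whisker_exchange_assoc, h3]
      simp [reassoc_of% h1, h4, reassoc_of% h2])
    (fun a a' c d => by
      rw [← Iso.inv_comp_eq]
      refine ι_extLR fun b => ?_
      have h1 := congrArg (· ▷ P.obj c d) (ι_lact M N a a' b c)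
      simp only [comp_whiskerRight] at h1
      have h2 := congrArg (A.hom a a' ◁ ·) (ι_assocAux M N P a' b c d)
      simp only [whiskerLeft_comp] at h2
      have h3 := ι_lact M (tensor N P) a a' b d
      have h4 := ι_assocAux M N P a b c d
      rw [← whisker_assoc_symm_aux, reassoc_of% h1, h4, reassoc_of% h2, h3,
        associator_naturality_left_assoc, ← whisker_exchange_assoc]
      simp)
    (fun a c d d' => by
      rw [← cancel_epi (α_ _ _ _).inv, Iso.inv_hom_id_assoc]
      refine ι_extR fun b => ?_
      have h1 := congrArg (· ▷ D.hom d d') (ι_assocAux M N P a b c d)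
      simp only [comp_whiskerRight] at h1
      have h2 := congrArg (M.obj a b ◁ ·) (ι_ract N P b c d d')
      simp only [whiskerLeft_comp] at h2
      have h3 := ι_ract M (tensor N P) a b d d'
      have h4 := ι_assocAux M N P a b c d'
      rw [← whisker_exchange_assoc, h4]
      simp [reassoc_of% h1, h3, reassoc_of% h2])

theorem ι_assocHom (a : A.ob) (c : C.ob) (d : D.ob) :
    ι (tensor M N) P a c d ≫ (assocHom M N P).app a d = assocAux M N P a c d :=
  ι_tensorHom _ _ _ _ a c d

theorem ι_ι_assocHom (a : A.ob) (b : B.ob) (c : C.ob) (d : D.ob) :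
    ι M N a b c ▷ P.obj c d ≫ ι (tensor M N) P a c d ≫ (assocHom M N P).app a d =
      (α_ _ _ _).hom ≫ M.obj a b ◁ ι N P b c d ≫ ι M (tensor N P) a b d := by
  rw [ι_assocHom, ι_assocAux]

/-- Auxiliary map for the inverse of the associator. -/
noncomputable def assocInvAux (a : A.ob) (b : B.ob) (d : D.ob) :
    M.obj a b ≫ (tensor N P).obj b d ⟶ (tensor (tensor M N) P).obj a d :=
  descL N P (M.obj a b)
    (fun c => (α_ _ _ _).inv ≫ ι M N a b c ▷ P.obj c d ≫ ι (tensor M N) P a c d)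
    (fun c c' => by
      have h1 := congrArg (· ▷ P.obj c' d) (ι_ract M N a b c c')
      simp only [comp_whiskerRight] at h1
      have h2 := ι_balanced (tensor M N) P a c c' d
      rw [← whisker_assoc_symm_aux, Iso.inv_comp_eq, ← cancel_epi ((α_ _ _ _).hom ▷ _),
        ← reassoc_of% h1, h2, associator_naturality_left_assoc, ← whisker_exchange_assoc]
      simp)

theorem ι_assocInvAux (a : A.ob) (b : B.ob) (c : C.ob) (d : D.ob) :
    M.obj a b ◁ ι N P b c d ≫ assocInvAux M N P a b d =
      (α_ _ _ _).inv ≫ ι M N a b c ▷ P.obj c d ≫ ι (tensor M N) P a c d :=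
  ι_descL N P (M.obj a b) _ _ c

/-- The components of the inverse of the associator. -/
noncomputable def assocInv (a : A.ob) (d : D.ob) :
    (tensor M (tensor N P)).obj a d ⟶ (tensor (tensor M N) P).obj a d :=
  desc M (tensor N P) (fun b => assocInvAux M N P a b d)
    (fun b b' => by
      refine ι_extL fun c => ?_
      have h1 := congrArg (M.obj a b ◁ ·) (ι_lact N P b b' c d)
      simp only [whiskerLeft_comp] at h1
      have h2 := congrArg (· ▷ P.obj c d) (ι_balanced M N a b b' c)
      simp only [comp_whiskerRight] at h2
      have h3 := ι_assocInvAux M N P a b c d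
      have h4 := ι_assocInvAux M N P a b' c d
      rw [whisker_exchange_assoc, h4]
      simp [reassoc_of% h1, h3, reassoc_of% h2])

theorem ι_assocInv (a : A.ob) (b : B.ob) (d : D.ob) :
    ι M (tensor N P) a b d ≫ assocInv M N P a d = assocInvAux M N P a b d :=
  ι_desc _ _ _ _ b

/-- The associator. -/
noncomputable def assocIso : tensor (tensor M N) P ≅ tensor M (tensor N P) :=
  isoMk (assocHom M N P) (assocInv M N P)
    (fun a d => ι_ext fun c => ι_extR fun b => by
      rw [reassoc_of% (ι_ι_assocHom M N P a b c d), ι_assocInv, ι_assocInvAux]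
      simp)
    (fun a d => ι_ext fun b => ι_extL fun c => by
      rw [reassoc_of% (ι_assocInv M N P a b d), reassoc_of% (ι_assocInvAux M N P a b c d),
        ι_ι_assocHom]
      simp)

end Associator

section Laws

theorem whiskerL_id (M : WProf A B) (N : WProf B C) : whiskerL M (𝟙 N) = 𝟙 (tensor M N) :=
  tensor_hom_ext fun a b c => by rw [ι_whiskerL]; simp

theorem whiskerL_comp (M : WProf A B) {N N' N'' : WProf B C} (f : N ⟶ N') (g : N' ⟶ N'') :
    whiskerL M (f ≫ g) = whiskerL M f ≫ whiskerL M g :=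
  tensor_hom_ext fun a b c => by
    rw [ι_whiskerL, comp_app, comp_app, reassoc_of% (ι_whiskerL M f a b c), ι_whiskerL]; simp

theorem whiskerR_id (M : WProf A B) (N : WProf B C) : whiskerR (𝟙 M) N = 𝟙 (tensor M N) :=
  tensor_hom_ext fun a b c => by rw [ι_whiskerR]; simp

theorem whiskerR_comp {M M' M'' : WProf A B} (f : M ⟶ M') (g : M' ⟶ M'') (N : WProf B C) :
    whiskerR (f ≫ g) N = whiskerR f N ≫ whiskerR g N :=
  tensor_hom_ext fun a b c => by
    rw [ι_whiskerR, comp_app, comp_app, reassoc_of% (ι_whiskerR f N a b c), ι_whiskerR]; simp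

theorem whisker_exch {M M' : WProf A B} {N N' : WProf B C} (f : M ⟶ M') (g : N ⟶ N') :
    whiskerL M g ≫ whiskerR f N' = whiskerR f N ≫ whiskerL M' g :=
  tensor_hom_ext fun a b c => by
    rw [comp_app, comp_app, reassoc_of% (ι_whiskerL M g a b c), ι_whiskerR,
      reassoc_of% (ι_whiskerR f N a b c), ι_whiskerL, whisker_exchange_assoc]

theorem id_whiskerL {M N : WProf A B} (f : M ⟶ N) :
    whiskerL (idProf A) f ≫ lUnitorHom N = lUnitorHom M ≫ f :=
  tensor_hom_ext fun a b c => by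
    rw [comp_app, comp_app, reassoc_of% (ι_whiskerL (idProf A) f a b c), ι_lUnitorHom,
      ← Category.assoc, ι_lUnitorHom, f.lact_app]

theorem id_whiskerR {M N : WProf A B} (f : M ⟶ N) :
    whiskerR f (idProf B) ≫ rUnitorHom N = rUnitorHom M ≫ f :=
  tensor_hom_ext fun a b c => by
    rw [comp_app, comp_app, reassoc_of% (ι_whiskerR f (idProf B) a b c), ι_rUnitorHom,
      ← Category.assoc, ι_rUnitorHom, f.ract_app]

theorem tensor_whiskerL (M : WProf A B) (N : WProf B C) {P P' : WProf C D} (f : P ⟶ P') :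
    whiskerL (tensor M N) f ≫ assocHom M N P' = assocHom M N P ≫ whiskerL M (whiskerL N f) :=
  tensor_hom_ext fun a c d => ι_extR fun b => by
    have h := congrArg (M.obj a b ◁ ·) (ι_whiskerL N f b c d)
    simp only [whiskerLeft_comp] at h
    rw [comp_app, comp_app, reassoc_of% (ι_whiskerL (tensor M N) f a c d),
      reassoc_of% (ι_ι_assocHom M N P a b c d), ι_whiskerL, reassoc_of% h,
      ← whisker_exchange_assoc, ι_ι_assocHom]
    simp

theorem whiskerR_tensor {M M' : WProf A B} (f : M ⟶ M') (N : WProf B C) (P : WProf C D) :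
    whiskerR (whiskerR f N) P ≫ assocHom M' N P = assocHom M N P ≫ whiskerR f (tensor N P) :=
  tensor_hom_ext fun a c d => ι_extR fun b => by
    have h := congrArg (· ▷ P.obj c d) (ι_whiskerR f N a b c)
    simp only [comp_whiskerRight] at h
    rw [comp_app, comp_app, reassoc_of% (ι_whiskerR (whiskerR f N) P a c d),
      reassoc_of% (ι_ι_assocHom M N P a b c d), ι_whiskerR, reassoc_of% h,
      ι_ι_assocHom, whisker_exchange_assoc]
    simp

theorem whisker_middle (M : WProf A B) {N N' : WProf B C} (f : N ⟶ N') (P : WProf C D) :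
    whiskerR (whiskerL M f) P ≫ assocHom M N' P = assocHom M N P ≫ whiskerL M (whiskerR f P) :=
  tensor_hom_ext fun a c d => ι_extR fun b => by
    have h := congrArg (· ▷ P.obj c d) (ι_whiskerL M f a b c)
    simp only [comp_whiskerRight] at h
    have h' := congrArg (M.obj a b ◁ ·) (ι_whiskerR f P b c d)
    simp only [whiskerLeft_comp] at h'
    rw [comp_app, comp_app, reassoc_of% (ι_whiskerR (whiskerL M f) P a c d),
      reassoc_of% (ι_ι_assocHom M N P a b c d), ι_whiskerL, reassoc_of% h, reassoc_of% h',
      ι_ι_assocHom]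
    simp

theorem assoc_triangle (M : WProf A B) (N : WProf B C) :
    assocHom M (idProf B) N ≫ whiskerL M (lUnitorHom N) = whiskerR (rUnitorHom M) N :=
  tensor_hom_ext fun a b' c => ι_extR fun b => by
    have h := congrArg (· ▷ N.obj b' c) (ι_rUnitorHom M a b b')
    simp only [comp_whiskerRight] at h
    have h' := congrArg (M.obj a b ◁ ·) (ι_lUnitorHom N b b' c)
    simp only [whiskerLeft_comp] at h'
    rw [comp_app, reassoc_of% (ι_ι_assocHom M (idProf B) N a b b' c), ι_whiskerL,
      reassoc_of% h', ι_whiskerR, reassoc_of% h, ι_balanced]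

theorem assoc_pentagon (M : WProf A B) (N : WProf B C) (P : WProf C D) (Q : WProf D E) :
    whiskerR (assocHom M N P) Q ≫ assocHom M (tensor N P) Q ≫ whiskerL M (assocHom N P Q) =
      assocHom (tensor M N) P Q ≫ assocHom M N (tensor P Q) :=
  tensor_hom_ext fun a d e => ι_extR fun c => by
    rw [← cancel_epi (α_ _ _ _).inv]
    refine ι_extR fun b => ?_
    have h1 := congrArg (· ▷ Q.obj d e) (ι_ι_assocHom M N P a b c d)
    simp only [comp_whiskerRight] at h1
    have h2 := congrArg (M.obj a b ◁ ·) (ι_ι_assocHom N P Q b c d e)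
    simp only [whiskerLeft_comp] at h2
    have h3 := ι_ι_assocHom M (tensor N P) Q a b d e
    have h4 := ι_ι_assocHom (tensor M N) P Q a c d e
    have h5 := ι_ι_assocHom M N (tensor P Q) a b c e
    simp only [comp_app]
    rw [reassoc_of% h4, Iso.inv_hom_id_assoc, ← whisker_exchange_assoc, h5,
      reassoc_of% (ι_whiskerR (assocHom M N P) Q a d e),
      associator_inv_naturality_left_assoc, reassoc_of% h1, reassoc_of% h3, ι_whiskerL,
      ← Category.assoc ((M.obj a b ◁ ι N P b c d) ▷ Q.obj d e)]
    simp [reassoc_of% h2]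

end Laws

end WProf

/-- The bicategory of small `W`-categories, profunctors and profunctor maps. The composite
`M ≫ N` of `M : A ⇸ B` and `N : B ⇸ C` is the tensor product of `M` and `N` over `B`. -/
noncomputable instance WMod.bicategory (W : Type u) [Bicategory.{w, v} W] [BiclosedBicategory W] :
    Bicategory.{w, max w v} (WMod W) where
  Hom A B := WProf A B
  id A := WProf.idProf A
  comp M N := WProf.tensor M N
  homCategory A B := WProf.category A B
  whiskerLeft M _ _ g := WProf.whiskerL M g
  whiskerRight f N := WProf.whiskerR f N
  associator M N P := WProf.assocIso M N P
  leftUnitor M := WProf.lUnitor M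
  rightUnitor M := WProf.rUnitor M
  whiskerLeft_id M N := WProf.whiskerL_id M N
  whiskerLeft_comp M _ _ _ f g := WProf.whiskerL_comp M f g
  id_whiskerLeft {_ _ _ N} f := by
    rw [← Category.assoc, Iso.eq_comp_inv]
    exact WProf.id_whiskerL f
  comp_whiskerLeft M N _ P' f := by
    rw [← Category.assoc, Iso.eq_comp_inv]
    exact WProf.tensor_whiskerL M N f
  id_whiskerRight M N := WProf.whiskerR_id M N
  comp_whiskerRight f g N := WProf.whiskerR_comp f g N
  whiskerRight_id f := by
    rw [← Category.assoc, Iso.eq_comp_inv]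
    exact WProf.id_whiskerR f
  whiskerRight_comp f N P := by
    rw [Iso.eq_inv_comp]
    exact (WProf.whiskerR_tensor f N P).symm
  whisker_assoc M _ _ f P := by
    rw [← Category.assoc, Iso.eq_comp_inv]
    exact WProf.whisker_middle M f P
  whisker_exchange f g := WProf.whisker_exch f g
  pentagon M N P Q := WProf.assoc_pentagon M N P Q
  triangle M N := WProf.assoc_triangle M N

namespace WCat

section Fibres

variable {W : Type u} [Bicategory.{w, v} W] (C : WCat.{w, v, u, u₁} W)

/-- The objects of `C` of extent `x`. -/
def Fib (x : W) : Type u₁ := {c : C.ob // C.ext c = x}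

/-- The hom-objects of `C`, between objects of prescribed extents. -/
def fhom : {x y : W} → C.Fib x → C.Fib y → (x ⟶ y)
  | _, _, ⟨c, rfl⟩, ⟨d, rfl⟩ => C.hom c d

/-- The identities of `C`, on an object of prescribed extent. -/
def fid : {x : W} → (c : C.Fib x) → (𝟙 x ⟶ C.fhom c c)
  | _, ⟨c, rfl⟩ => C.id c

/-- The composition of `C`, between objects of prescribed extents. -/
def fcomp : {x y z : W} → (c : C.Fib x) → (d : C.Fib y) → (e : C.Fib z) →
    (C.fhom c d ≫ C.fhom d e ⟶ C.fhom c e)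
  | _, _, _, ⟨c, rfl⟩, ⟨d, rfl⟩, ⟨e, rfl⟩ => C.comp c d e

theorem fid_comp {x y : W} (c : C.Fib x) (d : C.Fib y) :
    C.fid c ▷ C.fhom c d ≫ C.fcomp c c d = (λ_ (C.fhom c d)).hom := by
  obtain ⟨c, rfl⟩ := c
  obtain ⟨d, rfl⟩ := d
  exact C.id_comp c d

theorem fcomp_id {x y : W} (c : C.Fib x) (d : C.Fib y) :
    C.fhom c d ◁ C.fid d ≫ C.fcomp c d d = (ρ_ (C.fhom c d)).hom := by
  obtain ⟨c, rfl⟩ := c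
  obtain ⟨d, rfl⟩ := d
  exact C.comp_id c d

theorem fassoc {x y z t : W} (c : C.Fib x) (d : C.Fib y) (e : C.Fib z) (f : C.Fib t) :
    C.fcomp c d e ▷ C.fhom e f ≫ C.fcomp c e f =
      (α_ _ _ _).hom ≫ C.fhom c d ◁ C.fcomp d e f ≫ C.fcomp c d f := by
  obtain ⟨c, rfl⟩ := c
  obtain ⟨d, rfl⟩ := d
  obtain ⟨e, rfl⟩ := e
  obtain ⟨f, rfl⟩ := f
  exact C.assoc c d e f

end Fibres

/-- The small `W`-category with one object, of extent `x`, and hom-object the identity of `x`. -/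
def unit {W : Type u} [Bicategory.{w, v} W] (x : W) : WMod W where
  ob := PUnit
  ext _ := x
  hom _ _ := 𝟙 x
  id _ := 𝟙 (𝟙 x)
  comp _ _ _ := (λ_ (𝟙 x)).hom
  id_comp _ _ := by simp
  comp_id _ _ := by simp [unitors_equal]
  assoc _ _ _ _ := by simp [unitors_equal]

end WCat

/-- A `W`-functor from `A` to `C`: an extent-preserving assignment on objects with an action on
hom-objects that respects identities and composition. -/
structure WFunctor {W : Type u} [Bicategory.{w, v} W] (A : WCat.{w, v, u, u₁} W)
    (C : WCat.{w, v, u, u₂} W) where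
  obj : ∀ a : A.ob, C.Fib (A.ext a)
  map : ∀ a b, A.hom a b ⟶ C.fhom (obj a) (obj b)
  map_id : ∀ a, A.id a ≫ map a a = C.fid (obj a)
  map_comp : ∀ a b c, A.comp a b c ≫ map a c =
    map a b ▷ A.hom b c ≫ C.fhom (obj a) (obj b) ◁ map b c ≫ C.fcomp (obj a) (obj b) (obj c)

namespace WFunctor

variable {W : Type u} [Bicategory.{w, v} W] {A B D : WMod W} {C : WCat.{w, v, u, u₁} W}

/-- An object of `C` of extent `x`, as a functor from the one-object category on `x`. -/
def pt {x : W} (c : C.Fib x) : WFunctor (WCat.unit x) C where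
  obj _ := c
  map _ _ := C.fid c
  map_id _ := by
    change 𝟙 (𝟙 x) ≫ C.fid c = C.fid c
    simp
  map_comp _ _ _ := by
    change (λ_ (𝟙 x)).hom ≫ C.fid c = C.fid c ▷ 𝟙 x ≫ C.fhom c c ◁ C.fid c ≫ C.fcomp c c c
    rw [C.fcomp_id, rightUnitor_naturality, unitors_equal]

/-- An object `c` of `C`, as a functor from the one-object category on the extent of `c`. -/
abbrev ofOb (C : WCat.{w, v, u, u₁} W) (c : C.ob) : WFunctor (WCat.unit (C.ext c)) C :=
  pt ⟨c, rfl⟩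

/-- The profunctor `C(G, F) : A ⇸ B` of functors `F : A → C` and `G : B → C`, with components
`C(G b, F a)`. -/
def homProf (G : WFunctor B C) (F : WFunctor A C) : WProf A B where
  obj a b := C.fhom (F.obj a) (G.obj b)
  lact a a' b := F.map a a' ▷ C.fhom (F.obj a') (G.obj b) ≫ C.fcomp _ _ _
  ract a b b' := C.fhom (F.obj a) (G.obj b) ◁ G.map b b' ≫ C.fcomp _ _ _
  id_lact a b := by
    rw [← Category.assoc, ← comp_whiskerRight, F.map_id, C.fid_comp]
  comp_lact a a' a'' b := by
    rw [← Category.assoc, ← comp_whiskerRight, F.map_comp]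
    have h := C.fassoc (F.obj a) (F.obj a') (F.obj a'') (G.obj b)
    simp only [comp_whiskerRight, Category.assoc, h, whiskerLeft_comp]
    rw [whisker_exchange_assoc, whisker_exchange_assoc]
    simp
  ract_id a b := by
    rw [← Category.assoc, ← whiskerLeft_comp, G.map_id, C.fcomp_id]
  ract_ract a b b' b'' := by
    have h := C.fassoc (F.obj a) (G.obj b) (G.obj b') (G.obj b'')
    rw [← Category.assoc (C.fhom (F.obj a) (G.obj b) ◁ B.comp b b' b''), ← whiskerLeft_comp,
      G.map_comp, comp_whiskerRight, Category.assoc, ← whisker_exchange_assoc, h]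
    simp
  lact_ract a a' b b' := by
    have h := C.fassoc (F.obj a) (F.obj a') (G.obj b) (G.obj b')
    rw [comp_whiskerRight, Category.assoc, ← whisker_exchange_assoc, h, whiskerLeft_comp,
      Category.assoc, whisker_exchange_assoc, whisker_exchange_assoc]
    simp

/-- The action of `Z` on hom-objects, as a profunctor map `A → C(Z, Z)`. -/
def homMap (Z : WFunctor A C) : WProf.idProf A ⟶ homProf Z Z where
  app a b := Z.map a b
  lact_app a a' b := by
    dsimp [homProf]
    rw [Z.map_comp, whisker_exchange_assoc]
  ract_app a b b' := Z.map_comp a b b'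

variable [BiclosedBicategory W]

/-- Composition in `C`, as a profunctor map `C(F, Z) ⊗_A C(Z, G) → C(F, G)`. -/
noncomputable def homComp (F : WFunctor B C) (Z : WFunctor A C) (G : WFunctor D C) :
    WProf.tensor (homProf Z G) (homProf F Z) ⟶ homProf F G :=
  WProf.tensorHom (fun d a b => C.fcomp (G.obj d) (Z.obj a) (F.obj b))
    (fun d a a' b => by
      have h := C.fassoc (G.obj d) (Z.obj a) (Z.obj a') (F.obj b)
      dsimp [homProf]
      simp [h])
    (fun d d' a b => by
      have h := C.fassoc (G.obj d) (G.obj d') (Z.obj a) (F.obj b)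
      dsimp [homProf]
      rw [whisker_exchange_assoc]
      simp [h])
    (fun d a b b' => by
      have h := C.fassoc (G.obj d) (Z.obj a) (F.obj b) (F.obj b')
      dsimp [homProf]
      rw [← whisker_exchange_assoc, h]
      simp)

end WFunctor

section Weighted

variable {W : Type u} [Bicategory.{w, v} W] [BiclosedBicategory W]

/-- `u : N ⊗_B M → L` exhibits `M` as `[N, L]`: every `f : N ⊗_B K → L` is `u ∘ (N ⊗_B g)` for a
unique `g : K → M`. -/
def ExhibitsRightLift {A B C : WMod W} {M : A ⟶ B} {N : B ⟶ C} {L : A ⟶ C}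
    (u : M ≫ N ⟶ L) : Prop :=
  ∀ (K : A ⟶ B) (f : K ≫ N ⟶ L), ∃! g : K ⟶ M, g ▷ N ≫ u = f

/-- `u : N ⊗_B M → L` exhibits `N` as `⟨M, L⟩`: every `f : K ⊗_B M → L` is `u ∘ (g ⊗_B M)` for a
unique `g : K → N`. -/
def ExhibitsRightExtension {A B C : WMod W} {M : A ⟶ B} {N : B ⟶ C} {L : A ⟶ C}
    (u : M ≫ N ⟶ L) : Prop :=
  ∀ (K : B ⟶ C) (f : M ≫ K ⟶ L), ∃! g : K ⟶ N, M ◁ g ≫ u = f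

variable {A B D : WMod W} {C : WCat.{w, v, u, u₁} W}

/-- The profunctor `C(G, F) : A ⇸ B`, as a 1-cell of the bicategory of modules. -/
abbrev WFunctor.hom (G : WFunctor B C) (F : WFunctor A C) : A ⟶ B := WFunctor.homProf G F

/-- Composition in `C`, as a 2-cell `C(F, Z) ⊗_A C(Z, G) → C(F, G)` of modules. -/
noncomputable abbrev WFunctor.μ (F : WFunctor B C) (Z : WFunctor A C) (G : WFunctor D C) :
    Z.hom G ≫ F.hom Z ⟶ F.hom G := WFunctor.homComp F Z G

/-- The effect of `Z` on homs, as a 2-cell `A → C(Z, Z)` of modules. -/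
abbrev WFunctor.onHom (Z : WFunctor A C) : 𝟙 A ⟶ Z.hom Z := WFunctor.homMap Z

/-- `a : φ → C(F, Z)` exhibits `Z` as a `φ`-weighted colimit of `F`: for each object `c` of `C`,
`φ ⊗_A C(Z, c) → C(F, Z) ⊗_A C(Z, c) → C(F, c)` exhibits `C(Z, c)` as `[φ, C(F, c)]`. -/
def IsWeightedColimit (φ : A ⟶ B) (F : WFunctor B C) (Z : WFunctor A C) (a : φ ⟶ F.hom Z) : Prop :=
  ∀ c : C.ob, ExhibitsRightLift
    (Z.hom (WFunctor.ofOb C c) ◁ a ≫ WFunctor.μ F Z (WFunctor.ofOb C c))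

/-- `b : ψ → C(Z, F)` exhibits `Z` as a `ψ`-weighted limit of `F`: for each object `c` of `C`,
`C(c, Z) ⊗_A ψ → C(c, Z) ⊗_A C(Z, F) → C(c, F)` exhibits `C(c, Z)` as `⟨ψ, C(c, F)⟩`. -/
def IsWeightedLimit (ψ : B ⟶ A) (F : WFunctor B C) (Z : WFunctor A C) (b : ψ ⟶ Z.hom F) : Prop :=
  ∀ c : C.ob, ExhibitsRightExtension
    (b ▷ (WFunctor.ofOb C c).hom Z ≫ WFunctor.μ (WFunctor.ofOb C c) Z F)

/-- Commutativity of the two squares: the composite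
`A → ψ ⊗_B φ → C(Z, F) ⊗_B C(F, Z) → C(Z, Z)` is the effect of `Z` on homs, and
`φ ⊗_A ψ → C(F, Z) ⊗_A C(Z, F) → C(F, F)` is the counit followed by the effect of `F` on homs. -/
structure AbsoluteSquares {φ : A ⟶ B} {ψ : B ⟶ A} (adj : Bicategory.Adjunction φ ψ)
    (F : WFunctor B C) (Z : WFunctor A C) (a : φ ⟶ F.hom Z) (b : ψ ⟶ Z.hom F) : Prop where
  unit_square : adj.unit ≫ (a ▷ ψ ≫ F.hom Z ◁ b) ≫ WFunctor.μ Z F Z = Z.onHom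
  counit_square : (b ▷ φ ≫ Z.hom F ◁ a) ≫ WFunctor.μ F Z F = adj.counit ≫ F.onHom

end Weighted

/-!
Fix a category `C` enriched in a bicategory, and regard a 2-cell `p : X ⟶ C.hom x y` as a
generalised arrow from `x` to `y` of shape `X`. Such arrows multiply, with shapes composing, and the
product is associative and unital up to the structure of the bicategory. For `φ ⊣ ψ`, the pairs in
(c) are then pairs of generalised arrows `a` of shape `φ` and `b` of shape `ψ` that are mutually
inverse up to the unit and the counit. As in a monoid, such an `a` has at most one inverse, and it
has one exactly when multiplication by `a` is bijective: this says that `a` exhibits a copower.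

The small categories over `C` form a category enriched in `WMod W`, so the argument applies to them,
and the copowers there are the weighted colimits of the theorem. These are only tested against the
objects of `C` instead of all functors into `C`; but along a left adjoint `φ` the universal property
amounts to the invertibility of a mate, which is a pointwise condition.
-/

section Mates

variable {𝔹 : Type u} [Bicategory.{w, v} 𝔹] {x y z : 𝔹} {φ : x ⟶ y} {ψ : y ⟶ x}
  (adj : Bicategory.Adjunction φ ψ)

theorem homEquiv₂_whiskerRight_comp {f f' : z ⟶ x} {g : z ⟶ y} (s : f ⟶ f') (k : f' ≫ φ ⟶ g) :
    adj.homEquiv₂ (s ▷ φ ≫ k) = s ≫ adj.homEquiv₂ k := by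
  simp only [Adjunction.homEquiv₂_apply, comp_whiskerRight]
  rw [rightUnitor_inv_naturality_assoc, ← whisker_exchange_assoc]
  simp

theorem homEquiv₁_symm_whiskerLeft_comp {f f' : x ⟶ z} {g : y ⟶ z} (s : f ⟶ f')
    (k : ψ ≫ f' ⟶ g) : adj.homEquiv₁.symm (ψ ◁ s ≫ k) = s ≫ adj.homEquiv₁.symm k := by
  simp only [Adjunction.homEquiv₁_symm_apply, whiskerLeft_comp]
  rw [leftUnitor_inv_naturality_assoc, whisker_exchange_assoc]
  simp

theorem isIso_homEquiv₂_iff {f : z ⟶ x} {g : z ⟶ y} (k : f ≫ φ ⟶ g) :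
    IsIso (adj.homEquiv₂ k) ↔ ∀ (K : z ⟶ x) (p : K ≫ φ ⟶ g), ∃! q : K ⟶ f, q ▷ φ ≫ k = p := by
  rw [isIso_iff_yoneda_map_bijective]
  refine forall_congr' fun K => ?_
  rw [Function.bijective_iff_existsUnique, adj.homEquiv₂.surjective.forall]
  simp only [← homEquiv₂_whiskerRight_comp, EmbeddingLike.apply_eq_iff_eq]

theorem isIso_homEquiv₁_symm_iff {f : x ⟶ z} {g : y ⟶ z} (k : ψ ≫ f ⟶ g) :
    IsIso (adj.homEquiv₁.symm k) ↔
      ∀ (K : x ⟶ z) (p : ψ ≫ K ⟶ g), ∃! q : K ⟶ f, ψ ◁ q ≫ k = p := by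
  rw [isIso_iff_yoneda_map_bijective]
  refine forall_congr' fun K => ?_
  rw [Function.bijective_iff_existsUnique, adj.homEquiv₁.symm.surjective.forall]
  simp only [← homEquiv₁_symm_whiskerLeft_comp, EmbeddingLike.apply_eq_iff_eq]

end Mates

namespace WCat

variable {𝔹 : Type u} [Bicategory.{w, v} 𝔹] (C : WCat.{w, v, u, u₁} 𝔹)

section Product

variable {x y z t : C.ob} {X X' : C.ext x ⟶ C.ext y} {Y Y' : C.ext y ⟶ C.ext z}
  {T : C.ext z ⟶ C.ext t}

/-- The product of the generalised arrows `p` from `x` to `y`, of shape `X`, and `q` from `y` to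
`z`, of shape `Y`: a generalised arrow of shape `X ≫ Y`, in diagrammatic order. -/
def mul (p : X ⟶ C.hom x y) (q : Y ⟶ C.hom y z) : X ≫ Y ⟶ C.hom x z :=
  p ▷ Y ≫ C.hom x y ◁ q ≫ C.comp x y z

theorem mul_eq_whiskerLeft_comp (p : X ⟶ C.hom x y) (q : Y ⟶ C.hom y z) :
    C.mul p q = X ◁ q ≫ p ▷ C.hom y z ≫ C.comp x y z :=
  (whisker_exchange_assoc p q _).symm

theorem comp_mul (s : X' ⟶ X) (p : X ⟶ C.hom x y) (q : Y ⟶ C.hom y z) :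
    C.mul (s ≫ p) q = s ▷ Y ≫ C.mul p q := by
  simp [mul]

theorem mul_comp (p : X ⟶ C.hom x y) (s : Y' ⟶ Y) (q : Y ⟶ C.hom y z) :
    C.mul p (s ≫ q) = X ◁ s ≫ C.mul p q := by
  simp [mul_eq_whiskerLeft_comp]

theorem mul_assoc (p : X ⟶ C.hom x y) (q : Y ⟶ C.hom y z) (r : T ⟶ C.hom z t) :
    C.mul (C.mul p q) r = (α_ X Y T).hom ≫ C.mul p (C.mul q r) := by
  simp only [mul, comp_whiskerRight, whiskerLeft_comp, Category.assoc]
  rw [← whisker_exchange_assoc, C.assoc]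
  simp

theorem id_mul (p : X ⟶ C.hom x y) : C.mul (C.id x) p = (λ_ X).hom ≫ p := by
  rw [mul_eq_whiskerLeft_comp, C.id_comp, leftUnitor_naturality]

theorem mul_id (p : X ⟶ C.hom x y) : C.mul p (C.id y) = (ρ_ X).hom ≫ p := by
  rw [mul, C.comp_id, rightUnitor_naturality]

end Product

section Copowers

variable {z f : C.ob} {φ : C.ext z ⟶ C.ext f} {ψ : C.ext f ⟶ C.ext z}

/-- The generalised arrow `a` exhibits `z` as the copower of `f` by the 1-cell `φ`, that is, as the
colimit of the object `f` weighted by `φ`. -/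
def IsCopower (a : φ ⟶ C.hom z f) : Prop :=
  ∀ (g : C.ob) (K : C.ext g ⟶ C.ext z) (p : K ≫ φ ⟶ C.hom g f),
    ∃! q : K ⟶ C.hom g z, C.mul q a = p

/-- The generalised arrow `b` exhibits `z` as the power of `f` by the 1-cell `ψ`, that is, as the
limit of the object `f` weighted by `ψ`. -/
def IsPower (b : ψ ⟶ C.hom f z) : Prop :=
  ∀ (g : C.ob) (K : C.ext z ⟶ C.ext g) (p : ψ ≫ K ⟶ C.hom f g),
    ∃! q : K ⟶ C.hom z g, C.mul b q = p

/-- The generalised arrows `a` and `b`, whose shapes are adjoint 1-cells, are mutually inverse up to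
the unit and the counit of the adjunction. -/
structure MutuallyInverse (adj : Bicategory.Adjunction φ ψ) (a : φ ⟶ C.hom z f)
    (b : ψ ⟶ C.hom f z) : Prop where
  unit_mul : adj.unit ≫ C.mul a b = C.id z
  mul_counit : C.mul b a = adj.counit ≫ C.id f

variable {C} {adj : Bicategory.Adjunction φ ψ} {a : φ ⟶ C.hom z f} {b : ψ ⟶ C.hom f z}

theorem isPower_iff : C.IsPower b ↔
    ∀ (g : C.ob) (K : C.ext z ⟶ C.ext g) (p : ψ ≫ K ⟶ C.hom f g),
      ∃! q : K ⟶ C.hom z g, ψ ◁ q ≫ b ▷ C.hom z g ≫ C.comp f z g = p := by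
  simp only [IsPower, mul_eq_whiskerLeft_comp]

theorem MutuallyInverse.isCopower (h : C.MutuallyInverse adj a b) : C.IsCopower a := by
  refine fun g K p => ⟨adj.homEquiv₂ p ≫ C.mul (𝟙 _) b, ?_, ?_⟩
  · calc C.mul (adj.homEquiv₂ p ≫ C.mul (𝟙 _) b) a
        = adj.homEquiv₂ p ▷ φ ≫ (α_ _ _ _).hom ≫ C.mul (𝟙 _) (adj.counit ≫ C.id f) := by
          rw [comp_mul, mul_assoc, h.mul_counit]
      _ = adj.homEquiv₂.symm (adj.homEquiv₂ p) := by
          rw [mul_comp, mul_id, Category.comp_id, Adjunction.homEquiv₂_symm_apply]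
      _ = p := adj.homEquiv₂.symm_apply_apply p
  · rintro q rfl
    symm
    calc adj.homEquiv₂ (C.mul q a) ≫ C.mul (𝟙 _) b
        = (ρ_ K).inv ≫ K ◁ adj.unit ≫ (α_ _ _ _).inv ≫ C.mul (C.mul q a) b := by
          simp only [Adjunction.homEquiv₂_apply, Category.assoc, ← comp_mul, Category.comp_id]
      _ = (ρ_ K).inv ≫ C.mul q (adj.unit ≫ C.mul a b) := by
          rw [mul_assoc, Iso.inv_hom_id_assoc, mul_comp]
      _ = q := by rw [h.unit_mul, mul_id, Iso.inv_hom_id_assoc]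

theorem MutuallyInverse.isPower (h : C.MutuallyInverse adj a b) : C.IsPower b := by
  refine fun g K p => ⟨adj.homEquiv₁.symm p ≫ C.mul a (𝟙 _), ?_, ?_⟩
  · calc C.mul b (adj.homEquiv₁.symm p ≫ C.mul a (𝟙 _))
        = ψ ◁ adj.homEquiv₁.symm p ≫ (α_ _ _ _).inv ≫ C.mul (adj.counit ≫ C.id f) (𝟙 _) := by
          rw [mul_comp, ← h.mul_counit, mul_assoc, Iso.inv_hom_id_assoc]
      _ = adj.homEquiv₁ (adj.homEquiv₁.symm p) := by
          rw [comp_mul, id_mul, Category.comp_id, Adjunction.homEquiv₁_apply]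
      _ = p := adj.homEquiv₁.apply_symm_apply p
  · rintro q rfl
    symm
    calc adj.homEquiv₁.symm (C.mul b q) ≫ C.mul a (𝟙 _)
        = (λ_ K).inv ≫ adj.unit ▷ K ≫ (α_ _ _ _).hom ≫ C.mul a (C.mul b q) := by
          simp only [Adjunction.homEquiv₁_symm_apply, Category.assoc, ← mul_comp, Category.comp_id]
      _ = (λ_ K).inv ≫ C.mul (adj.unit ≫ C.mul a b) q := by
          rw [← mul_assoc, comp_mul]
      _ = q := by rw [h.unit_mul, id_mul, Iso.inv_hom_id_assoc]

theorem IsCopower.mutuallyInverse (ha : C.IsCopower a)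
    (hb : C.mul b a = adj.counit ≫ C.id f) : C.MutuallyInverse adj a b where
  unit_mul := by
    refine (ha z (𝟙 _) ((λ_ φ).hom ≫ a)).unique ?_ (C.id_mul a)
    calc C.mul (adj.unit ≫ C.mul a b) a
        = leftZigzag adj.unit adj.counit ≫ (ρ_ φ).hom ≫ a := by
          rw [comp_mul, mul_assoc, hb, mul_comp, mul_id]
          simp [leftZigzag, bicategoricalComp]
      _ = (λ_ φ).hom ≫ a := by rw [adj.left_triangle]; simp
  mul_counit := hb

theorem IsPower.mutuallyInverse (hb : C.IsPower b)
    (ha : C.mul b a = adj.counit ≫ C.id f) : C.MutuallyInverse adj a b where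
  unit_mul := by
    refine (hb z (𝟙 _) ((ρ_ ψ).hom ≫ b)).unique ?_ (C.mul_id b)
    calc C.mul b (adj.unit ≫ C.mul a b)
        = rightZigzag adj.unit adj.counit ≫ (λ_ ψ).hom ≫ b := by
          rw [mul_comp, ← Iso.inv_hom_id_assoc (α_ ψ φ ψ) (C.mul b _), ← mul_assoc, ha, comp_mul,
            id_mul]
          simp [rightZigzag, bicategoricalComp]
      _ = (ρ_ ψ).hom ≫ b := by rw [adj.right_triangle]; simp
  mul_counit := ha

theorem IsCopower.existsUnique_mutuallyInverse (adj : Bicategory.Adjunction φ ψ)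
    (ha : C.IsCopower a) : ∃! b, C.MutuallyInverse adj a b := by
  obtain ⟨b, hb, hb_unique⟩ := ha f ψ (adj.counit ≫ C.id f)
  exact ⟨b, ha.mutuallyInverse hb, fun b' hb' => hb_unique b' hb'.mul_counit⟩

theorem IsPower.existsUnique_mutuallyInverse (adj : Bicategory.Adjunction φ ψ)
    (hb : C.IsPower b) : ∃! a, C.MutuallyInverse adj a b := by
  obtain ⟨a, ha, ha_unique⟩ := hb f φ (adj.counit ≫ C.id f)
  exact ⟨a, hb.mutuallyInverse ha, fun a' ha' => ha_unique a' ha'.mul_counit⟩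

end Copowers

end WCat

namespace WFunctor

variable {W : Type u} [Bicategory.{w, v} W] [BiclosedBicategory W]
  {A B D E : WMod W} {C : WCat.{w, v, u, u₁} W}

theorem ι_homComp (F : WFunctor B C) (Z : WFunctor A C) (G : WFunctor D C) (d a b) :
    WProf.ι (homProf Z G) (homProf F Z) d a b ≫ WProfHom.app (homComp F Z G) d b =
      C.fcomp (G.obj d) (Z.obj a) (F.obj b) :=
  WProf.ι_tensorHom _ _ _ _ d a b

theorem homComp_assoc (H : WFunctor E C) (F : WFunctor B C) (Z : WFunctor A C)
    (G : WFunctor D C) :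
    WProf.whiskerR (homComp F Z G) (homProf H F) ≫ homComp H F G =
      WProf.assocHom (homProf Z G) (homProf F Z) (homProf H F) ≫
        WProf.whiskerL (homProf Z G) (homComp H F Z) ≫ homComp H Z G := by
  refine WProf.tensor_hom_ext fun d b e => WProf.ι_extR fun a => ?_
  simp only [WProf.comp_app]
  rw [reassoc_of% WProf.ι_whiskerR, reassoc_of% WProf.ι_ι_assocHom,
    reassoc_of% WProf.ι_whiskerL, ← comp_whiskerRight_assoc,
    ← whiskerLeft_comp_assoc, ι_homComp, ι_homComp, ι_homComp, ι_homComp]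
  exact C.fassoc _ _ _ _

theorem homMap_homComp (F : WFunctor B C) (G : WFunctor D C) :
    WProf.whiskerR (homMap G) (homProf F G) ≫ homComp F G G =
      WProf.lUnitorHom (homProf F G) := by
  refine WProf.tensor_hom_ext fun d d' b => ?_
  rw [WProf.comp_app, reassoc_of% WProf.ι_whiskerR, WProf.ι_lUnitorHom, ι_homComp]
  rfl

theorem homComp_homMap (Z : WFunctor A C) (G : WFunctor D C) :
    WProf.whiskerL (homProf Z G) (homMap Z) ≫ homComp Z Z G =
      WProf.rUnitorHom (homProf Z G) := by
  refine WProf.tensor_hom_ext fun d a a' => ?_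
  rw [WProf.comp_app, reassoc_of% WProf.ι_whiskerL, WProf.ι_rUnitorHom, ι_homComp]
  rfl

end WFunctor

/-- The functors from small `W`-categories to `C`, as a category enriched in `WMod W`: the extent of
a functor is its domain. -/
noncomputable def WCat.functors {W : Type u} [Bicategory.{w, v} W] [BiclosedBicategory W]
    (C : WCat.{w, v, u, u₁} W) : WCat (WMod W) where
  ob := Σ D : WMod W, WFunctor D C
  ext G := G.1
  hom G F := F.2.hom G.2
  id G := G.2.onHom
  comp G Z F := WFunctor.μ F.2 Z.2 G.2
  id_comp G F := WFunctor.homMap_homComp F.2 G.2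
  comp_id G Z := WFunctor.homComp_homMap Z.2 G.2
  assoc G Z F H := WFunctor.homComp_assoc H.2 F.2 Z.2 G.2

namespace WProf

variable {W : Type u} [Bicategory.{w, v} W] [BiclosedBicategory W] {A B : WMod W}

theorem isIso_iff_forall_isIso_app {M N : A ⟶ B} (f : M ⟶ N) :
    IsIso f ↔ ∀ a b, IsIso (WProfHom.app f a b) := by
  refine ⟨fun _ a b => ⟨WProfHom.app (inv f) a b, ?_, ?_⟩, fun h => ?_⟩
  · exact congrArg (fun g => WProfHom.app g a b) (IsIso.hom_inv_id f)
  · exact congrArg (fun g => WProfHom.app g a b) (IsIso.inv_hom_id f)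
  · exact (isoMk f (fun a b => inv (WProfHom.app f a b)) (fun _ _ => IsIso.hom_inv_id _)
      (fun _ _ => IsIso.inv_hom_id _)).isIso_hom

end WProf

section Reduction

variable {W : Type u} [Bicategory.{w, v} W] [BiclosedBicategory W]
  {A B D : WMod W} {C : WCat.{w, v, u, u₁} W} {φ : A ⟶ B} {ψ : B ⟶ A}
  {F : WFunctor B C} {Z : WFunctor A C}

open WFunctor

theorem IsWeightedColimit.exhibitsRightLift (adj : Bicategory.Adjunction φ ψ) {a : φ ⟶ F.hom Z}
    (h : IsWeightedColimit φ F Z a) (G : WFunctor D C) :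
    ExhibitsRightLift (Z.hom G ◁ a ≫ μ F Z G) := by
  refine (isIso_homEquiv₂_iff adj _).1 ((WProf.isIso_iff_forall_isIso_app _).2 fun d x => ?_)
  have isIso_pt {y : W} (c : C.Fib y) :
      IsIso (adj.homEquiv₂ (Z.hom (pt c) ◁ a ≫ μ F Z (pt c))) := by
    obtain ⟨c, rfl⟩ := c
    exact (isIso_homEquiv₂_iff adj _).2 (h c)
  -- The component at `(d, x)` depends on `G` through the object `G d` only.
  exact (WProf.isIso_iff_forall_isIso_app _).1 (isIso_pt (G.obj d)) PUnit.unit x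

theorem IsWeightedLimit.exhibitsRightExtension (adj : Bicategory.Adjunction φ ψ)
    {b : ψ ⟶ Z.hom F} (h : IsWeightedLimit ψ F Z b) (G : WFunctor D C) :
    ExhibitsRightExtension (b ▷ G.hom Z ≫ μ G Z F) := by
  refine (isIso_homEquiv₁_symm_iff adj _).1 ((WProf.isIso_iff_forall_isIso_app _).2 fun x d => ?_)
  have isIso_pt {y : W} (c : C.Fib y) :
      IsIso (adj.homEquiv₁.symm (b ▷ (pt c).hom Z ≫ μ (pt c) Z F)) := by
    obtain ⟨c, rfl⟩ := c
    exact (isIso_homEquiv₁_symm_iff adj _).2 (h c)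
  exact (WProf.isIso_iff_forall_isIso_app _).1 (isIso_pt (G.obj d)) x PUnit.unit

variable {adj : Bicategory.Adjunction φ ψ} {a : φ ⟶ F.hom Z} {b : ψ ⟶ Z.hom F}

theorem isWeightedColimit_iff_isCopower (adj : Bicategory.Adjunction φ ψ) :
    IsWeightedColimit φ F Z a ↔ C.functors.IsCopower (z := ⟨A, Z⟩) (f := ⟨B, F⟩) a :=
  ⟨fun h G => h.exhibitsRightLift adj G.2, fun h c => h ⟨_, ofOb C c⟩⟩

theorem isWeightedLimit_iff_isPower (adj : Bicategory.Adjunction φ ψ) :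
    IsWeightedLimit ψ F Z b ↔ C.functors.IsPower (z := ⟨A, Z⟩) (f := ⟨B, F⟩) b :=
  ⟨fun h => WCat.isPower_iff.2 fun G => h.exhibitsRightExtension adj G.2,
    fun h c => WCat.isPower_iff.1 h ⟨_, ofOb C c⟩⟩

theorem absoluteSquares_iff_mutuallyInverse :
    AbsoluteSquares adj F Z a b ↔
      C.functors.MutuallyInverse (z := ⟨A, Z⟩) (f := ⟨B, F⟩) adj a b := by
  have mul_ab : C.functors.mul (x := ⟨A, Z⟩) (y := ⟨B, F⟩) (z := ⟨A, Z⟩) a b =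
      (a ▷ ψ ≫ F.hom Z ◁ b) ≫ μ Z F Z := (Category.assoc _ _ _).symm
  have mul_ba : C.functors.mul (x := ⟨B, F⟩) (y := ⟨A, Z⟩) (z := ⟨B, F⟩) b a =
      (b ▷ φ ≫ Z.hom F ◁ a) ≫ μ F Z F := (Category.assoc _ _ _).symm
  exact ⟨fun h => ⟨mul_ab ▸ h.unit_square, mul_ba ▸ h.counit_square⟩,
    fun h => ⟨mul_ab ▸ h.unit_mul, mul_ba ▸ h.mul_counit⟩⟩

theorem AbsoluteSquares.isWeightedColimit (h : AbsoluteSquares adj F Z a b) :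
    IsWeightedColimit φ F Z a :=
  (isWeightedColimit_iff_isCopower adj).2 (absoluteSquares_iff_mutuallyInverse.1 h).isCopower

theorem AbsoluteSquares.isWeightedLimit (h : AbsoluteSquares adj F Z a b) :
    IsWeightedLimit ψ F Z b :=
  (isWeightedLimit_iff_isPower adj).2 (absoluteSquares_iff_mutuallyInverse.1 h).isPower

theorem IsWeightedColimit.existsUnique_absoluteSquares (adj : Bicategory.Adjunction φ ψ)
    (h : IsWeightedColimit φ F Z a) : ∃! b, AbsoluteSquares adj F Z a b := by
  simp only [absoluteSquares_iff_mutuallyInverse]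
  exact ((isWeightedColimit_iff_isCopower adj).1 h).existsUnique_mutuallyInverse adj

theorem IsWeightedLimit.existsUnique_absoluteSquares (adj : Bicategory.Adjunction φ ψ)
    (h : IsWeightedLimit ψ F Z b) : ∃! a, AbsoluteSquares adj F Z a b := by
  simp only [absoluteSquares_iff_mutuallyInverse]
  exact ((isWeightedLimit_iff_isPower adj).1 h).existsUnique_mutuallyInverse adj

end Reduction

section Graph

variable {α : Type u₁} {β : Type u₂} {r : α → β → Prop}

theorem bijOn_fst_of_existsUnique {s : Set α} (mem : ∀ a b, r a b → a ∈ s)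
    (existsUnique : ∀ a ∈ s, ∃! b, r a b) : Set.BijOn Prod.fst {p : α × β | r p.1 p.2} s := by
  refine ⟨fun p hp => mem _ _ hp, ?_, fun a ha => ?_⟩
  · rintro ⟨a, b⟩ hb ⟨_, b'⟩ hb' rfl
    exact congrArg (Prod.mk a) ((existsUnique a (mem a b hb)).unique hb hb')
  · obtain ⟨b, hb, -⟩ := existsUnique a ha
    exact ⟨(a, b), hb, rfl⟩

theorem bijOn_snd_of_existsUnique {s : Set β} (mem : ∀ a b, r a b → b ∈ s)
    (existsUnique : ∀ b ∈ s, ∃! a, r a b) : Set.BijOn Prod.snd {p : α × β | r p.1 p.2} s :=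
  (bijOn_fst_of_existsUnique (r := flip r) (fun b a => mem a b) existsUnique).comp
    ((Equiv.prodComm α β).bijOn' (fun _ h => h) (fun _ h => h))

end Graph

theorem theorem1 {W : Type u} [Bicategory.{w, v} W] [BiclosedBicategory W]
    {A B : WMod W} {C : WCat.{w, v, u, u₁} W} {φ : A ⟶ B} {ψ : B ⟶ A}
    (adj : Bicategory.Adjunction φ ψ) (F : WFunctor B C) (Z : WFunctor A C) :
    Set.BijOn Prod.fst
        {p : (φ ⟶ F.hom Z) × (ψ ⟶ Z.hom F) | AbsoluteSquares adj F Z p.1 p.2}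
        {a : φ ⟶ F.hom Z | IsWeightedColimit φ F Z a} ∧
      Set.BijOn Prod.snd
        {p : (φ ⟶ F.hom Z) × (ψ ⟶ Z.hom F) | AbsoluteSquares adj F Z p.1 p.2}
        {b : ψ ⟶ Z.hom F | IsWeightedLimit ψ F Z b} := by
  constructor
  · exact bijOn_fst_of_existsUnique (r := AbsoluteSquares adj F Z)
      (fun _ _ h => h.isWeightedColimit) fun _ ha => ha.existsUnique_absoluteSquares adj
  · exact bijOn_snd_of_existsUnique (r := AbsoluteSquares adj F Z)
      (fun _ _ h => h.isWeightedLimit) fun _ hb => hb.existsUnique_absoluteSquares adj
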